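/- **Setting.** Let $n\ge 0$. An *Euler integrand* is a function $$\mathcal I(\alpha,\epsilon)=\prod_{i=1}^n\alpha_i^{\nu_i(\epsilon)}\prod_{j=1}^m P_j(\alpha)^{c_j(\epsilon)},\qquad \alpha\in\mathbb R^n_{>0},\ \epsilon\in\mathbb C,$$ where the $P_j=\sum_{\mathbf m\in\mathbb Z^n}s_{j,\mathbf m}\alpha^{\mathbf m}$ are nonzero Laurent polynomials with coefficients $s_{j,\mathbf m}\ge 0$, and the exponents $\nu_i$ and $c_j$ are affine functions of $\epsilon$ with complex coefficients. For $\rho\in\mathbb R^n$ put $\mathrm{Trop}\,P_j(\rho)=\max_{s_{j,\mathbf m}\neq0}\rho\cdot\mathbf m$ and let $P_j|_\rho$ be the sum of the monomials $s_{j,\mathbf m}\alpha^{\mathbf m}$ with $\rho\cdot\mathbf m=\mathrm{Trop}\,P_j(\rho)$. Put $\mathrm{Trop}\,\mathcal I(\rho)=\nu\cdot\rho+\sum_j c_j\,\mathrm{Trop}\,P_j(\rho)$, an affine function of $\epsilon$, and $\mathcal I|_\rho=\alpha^{\nu}\prod_j(P_j|_\rho)^{c_j}$. Write $\alpha\lambda^{-\rho}=(\alpha_i\lambda^{-\rho_i})_i$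 and $P_j(\alpha\lambda^{-\rho})=\lambda^{-\mathrm{Trop}P_j(\rho)}P_j|_\rho(\alpha)\,(1+J_j)$, where $J_j$ is a finite sum of positive real powers of $\lambda$. The Puiseux series of $\mathcal I$ along $\rho$ is the expansion as $\lambda\to0^+$ $$\tau_\rho\mathcal I=\lambda^{-\mathrm{Trop}\,\mathcal I(\rho)}\;\mathcal I|_\rho(\alpha)\prod_j(1+J_j)^{c_j},$$ each factor $(1+J_j)^{c_j}$ being expanded by the binomial series. Its exponents are affine functions of $\epsilon$ and its coefficients are functions of $(\alpha,\epsilon)$. For a finite linear combination $\mathcal I=\sum_i\kappa_i\mathcal I_i$, $\kappa_i\in\mathbb C$, of Euler integrands put $\tau_\rho\mathcal I=\sum_i\kappa_i\,\tau_\rho\mathcal I_i$, where terms whose exponents are the same affine function of $\epsilon$ are collected and terms whose coefficient vanishes identically in $(\alpha,\epsilon)$ are dropped. $\mathrm{Trop}\,\mathcal I(\rho)$ is minus the exponent of the leading term of $\tau_\rho\mathcal I$ as $\lambda\to0^+$, that is, the maximum over the remaining exponents $e$ of $-\operatorname{Re}e(\epsilon)$ (the real part may be omitted if the exponents are real); it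 is $-\infty$ if no term remains. $\mathcal I$ is *locally finite* if expansion in $\epsilon$ at $0$ commutes with integration over $\mathbb R^n_{\ge0}$ against $\frac{d\alpha}{\alpha}=\prod_i\frac{d\alpha_i}{\alpha_i}$: the integral $\int\mathcal I\,\frac{d\alpha}\alpha$ converges absolutely for all $\epsilon$ near $0$ and is analytic at $\epsilon=0$, all integrals $\int\partial_\epsilon^k\mathcal I|_{\epsilon=0}\frac{d\alpha}\alpha$, $k\ge0$, converge absolutely, and $$\frac{d^k}{d\epsilon^k}\Big|_{\epsilon=0}\int_{\mathbb R^n_{\ge0}}\mathcal I\,\frac{d\alpha}{\alpha}=\int_{\mathbb R^n_{\ge0}}\partial_\epsilon^k\mathcal I\big|_{\epsilon=0}\,\frac{d\alpha}{\alpha}\qquad(k\ge0).$$ **Theorem.** A finite linear combination $\mathcal I=\sum_i\kappa_i\mathcal I_i$ of Euler integrands is locally finite if and only if for every $\rho\in\mathbb R^n\setminus\{0\}$ one has $\mathrm{Trop}\,\mathcal I(\rho)=a+\mathcal O(\epsilon)$ as $\epsilon\to0$ with some $a<0$ (depending on $\rho$; $a=-\infty$ is allowed and means $\mathrm{Trop}\,\mathcal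 I(\rho)=-\infty$). -/

import Mathlib

open MeasureTheory Filter Topology

noncomputable section

namespace Euler

/-- A nonzero Laurent polynomial `∑ m, s_m α ^ m` in `n` variables, `m ∈ ℤⁿ`, with non-negative
real coefficients `s_m`. -/
structure PosPoly (n : ℕ) where
  coeff : (Fin n → ℤ) →₀ ℝ
  nonneg : ∀ m, 0 ≤ coeff m
  ne_zero : coeff ≠ 0

/-- The monomial `α ^ m`. -/
def monom {n : ℕ} (m : Fin n → ℤ) (α : Fin n → ℝ) : ℝ := ∏ i, α i ^ m i

/-- The scalar product `ρ · m`. -/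
def pairing {n : ℕ} (ρ : Fin n → ℝ) (m : Fin n → ℤ) : ℝ := ∑ i, ρ i * (m i : ℝ)

/-- The affine function `a + b ε` of the parameter `ε`, represented by the pair `(a, b)`. -/
def affine (e : ℂ × ℂ) (ε : ℂ) : ℂ := e.1 + e.2 * ε

namespace PosPoly

variable {n : ℕ}

/-- The value of the polynomial at `α`. -/
def eval (P : PosPoly n) (α : Fin n → ℝ) : ℝ :=
  ∑ m ∈ P.coeff.support, P.coeff m * monom m α

theorem support_nonempty (P : PosPoly n) : P.coeff.support.Nonempty :=
  Finsupp.support_nonempty_iff.mpr P.ne_zero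

/-- `Trop P (ρ)`, the maximum of `ρ · m` over the exponent vectors `m` of `P`. -/
def trop (P : PosPoly n) (ρ : Fin n → ℝ) : ℝ :=
  P.coeff.support.sup' P.support_nonempty (pairing ρ)

open Classical in
/-- The initial form `P|_ρ`: the monomials of `P` on which `ρ · m` is maximal. -/
def initialForm (P : PosPoly n) (ρ α : Fin n → ℝ) : ℝ :=
  ∑ m ∈ P.coeff.support with pairing ρ m = P.trop ρ, P.coeff m * monom m α

open Classical in
/-- The series `J` in positive real powers of `λ` such that
`P(α λ ^ (-ρ)) = λ ^ (-Trop P (ρ)) * P|_ρ(α) * (1 + J)`. -/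
def remainder (P : PosPoly n) (ρ α : Fin n → ℝ) : HahnSeries ℝ ℂ :=
  ∑ m ∈ P.coeff.support with pairing ρ m ≠ P.trop ρ,
    HahnSeries.single (P.trop ρ - pairing ρ m)
      ((P.coeff m * monom m α / P.initialForm ρ α : ℝ) : ℂ)

end PosPoly

/-- The data of an Euler integrand `α ^ ν(ε) * ∏ j, P_j(α) ^ c_j(ε)` in `n` variables: the
exponents `ν_i` and `c_j` are affine functions of `ε`. -/
structure Integrand (n : ℕ) where
  ν : Fin n → ℂ × ℂ
  m : ℕ
  P : Fin m → PosPoly n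
  c : Fin m → ℂ × ℂ

namespace Integrand

variable {n : ℕ}

/-- The value of the Euler integrand at `α` (in the open positive orthant) and `ε`. -/
def eval (I : Integrand n) (α : Fin n → ℝ) (ε : ℂ) : ℂ :=
  (∏ i, (α i : ℂ) ^ affine (I.ν i) ε) * ∏ j, ((I.P j).eval α : ℂ) ^ affine (I.c j) ε

/-- `Trop I (ρ) = ν · ρ + ∑ j, c_j Trop P_j (ρ)`, an affine function of `ε`. -/
def trop (I : Integrand n) (ρ : Fin n → ℝ) : ℂ × ℂ :=
  ∑ i, (ρ i : ℂ) • I.ν i + ∑ j, ((I.P j).trop ρ : ℂ) • I.c j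

/-- The initial form `I|_ρ`. -/
def initialForm (I : Integrand n) (ρ α : Fin n → ℝ) (ε : ℂ) : ℂ :=
  (∏ i, (α i : ℂ) ^ affine (I.ν i) ε) *
    ∏ j, ((I.P j).initialForm ρ α : ℂ) ^ affine (I.c j) ε

/-- The expansion in non-negative real powers of `λ` of
`λ ^ (Trop I (ρ)) * I(α λ ^ (-ρ)) = I|_ρ(α) * ∏ j, (1 + J_j) ^ c_j`,
each factor `(1 + J_j) ^ c_j` being expanded by the binomial series. -/
def series (I : Integrand n) (ρ α : Fin n → ℝ) (ε : ℂ) : HahnSeries ℝ ℂ :=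
  I.initialForm ρ α ε •
    ∏ j, PowerSeries.heval ((I.P j).remainder ρ α)
      (PowerSeries.binomialSeries ℂ (affine (I.c j) ε))

open Classical in
/-- The coefficient of `λ ^ e(ε)` in the Puiseux series
`τ_ρ I = λ ^ (-Trop I (ρ)) * (series of λ ^ (Trop I (ρ)) * I(α λ ^ (-ρ)))`, for an affine
function `e` of `ε`. It can be nonzero only if `e = w - Trop I (ρ)` with a real constant `w`, and
then it is the coefficient of `λ ^ w` in `I.series`. -/
def tauCoeff (I : Integrand n) (ρ : Fin n → ℝ) (e : ℂ × ℂ) (α : Fin n → ℝ) (ε : ℂ) : ℂ :=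
  if e + I.trop ρ = ((((e + I.trop ρ).1.re : ℝ) : ℂ), 0) then
    (I.series ρ α ε).coeff (e + I.trop ρ).1.re
  else 0

end Integrand

/-- A finite linear combination `∑ i, κ_i I_i` of Euler integrands. -/
structure Combination (n : ℕ) where
  size : ℕ
  κ : Fin size → ℂ
  term : Fin size → Integrand n

namespace Combination

variable {n : ℕ}

/-- The value of the combination at `α` and `ε`. -/
def eval (I : Combination n) (α : Fin n → ℝ) (ε : ℂ) : ℂ :=
  ∑ i, I.κ i * (I.term i).eval α ε

/-- The coefficient of `λ ^ e(ε)` in `τ_ρ I`, where `τ_ρ` is extended linearly to combinations. -/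
def tauCoeff (I : Combination n) (ρ : Fin n → ℝ) (e : ℂ × ℂ) (α : Fin n → ℝ) (ε : ℂ) : ℂ :=
  ∑ i, I.κ i * (I.term i).tauCoeff ρ e α ε

/-- The exponents (affine functions of `ε`) that occur in `τ_ρ I`, i.e. those whose coefficient is
not identically zero as a function of `α` in the open positive orthant and of `ε`. -/
def exponents (I : Combination n) (ρ : Fin n → ℝ) : Set (ℂ × ℂ) :=
  {e | ∃ α : Fin n → ℝ, (∀ i, 0 < α i) ∧ ∃ ε : ℂ, I.tauCoeff ρ e α ε ≠ 0}

/-- `Trop I (ρ)` at `ε`: minus the exponent of the leading term of `τ_ρ I` as `λ → 0` (its real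
part, if exponents are complex). It is `-∞` if `τ_ρ I = 0`. -/
def trop (I : Combination n) (ρ : Fin n → ℝ) (ε : ℂ) : EReal :=
  ⨆ e ∈ I.exponents ρ, ((-(affine e ε).re : ℝ) : EReal)

/-- `Trop I (ρ) = a + O(ε)` as `ε → 0`. The value `a = -∞` stands for `Trop I (ρ) = -∞`. -/
def TropEq (I : Combination n) (ρ : Fin n → ℝ) (a : EReal) : Prop :=
  ∃ C : ℝ, ∀ᶠ ε in 𝓝 (0 : ℂ),
    I.trop ρ ε ≤ a + ((C * ‖ε‖ : ℝ) : EReal) ∧ a ≤ I.trop ρ ε + ((C * ‖ε‖ : ℝ) : EReal)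

end Combination

/-- The measure `dα / α = ∏ i, dα_i / α_i` on the positive orthant of `ℝⁿ` (whose boundary is a
Lebesgue null set). -/
def canonicalMeasure (n : ℕ) : Measure (Fin n → ℝ) :=
  (volume.restrict {α : Fin n → ℝ | ∀ i, 0 < α i}).withDensity
    fun α => ENNReal.ofReal (∏ i, (α i)⁻¹)

/-- Local finiteness: Taylor expansion in `ε` at `0` commutes with integration against `dα / α`.
The integral exists for `ε` near `0` and is analytic at `0`, every Taylor coefficient of the
integrand is integrable, and the Taylor coefficients of the integral are the integrals of the
Taylor coefficients. -/
structure LocallyFinite {n : ℕ} (I : Combination n) : Prop where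
  integrable : ∀ᶠ ε in 𝓝 (0 : ℂ), Integrable (fun α => I.eval α ε) (canonicalMeasure n)
  analyticAt : AnalyticAt ℂ (fun ε => ∫ α, I.eval α ε ∂canonicalMeasure n) 0
  integrable_taylor : ∀ k : ℕ,
    Integrable (fun α => iteratedDeriv k (I.eval α) 0) (canonicalMeasure n)
  taylor_eq : ∀ k : ℕ,
    iteratedDeriv k (fun ε => ∫ α, I.eval α ε ∂canonicalMeasure n) 0 =
      ∫ α, iteratedDeriv k (I.eval α) 0 ∂canonicalMeasure n

end Euler

end

/-!
# Tropical criterion for local finiteness of Euler integrals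

In logarithmic coordinates `α = exp x` the measure `dα / α` is the Lebesgue measure
(`canonicalMeasure_eq_map`), and `α λ ^ (-ρ)` with `λ = exp (-t)` is the point `x + t ρ`. The
Puiseux series along `ρ` is a genuine asymptotic expansion in exponentials of `t` as `t → ∞`
(`Combination.exists_isBigO_tau`); its coefficients are continuous in `x` and entire in `ε`, and
only finitely many exponents lie below a given bound. Hence the tropical condition at `ρ` just says
that every exponent of `τ_ρ I` has positive real part at `ε = 0` (`Combination.exists_tropEq_iff`).

*Necessity.* By Tonelli, absolute convergence at `ε` makes `t ↦ I(x + t ρ, ε)` integrable on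
`(0, ∞)` for almost all `x` (`ae_integrableOn_ray`). An integrable exponential sum has no
non-decaying term (`coeff_eq_zero_of_integrableOn_sum_exp`), so the coefficient of an exponent `e`
with `Re e(ε) ≤ 0` vanishes for almost all `x`, hence for all `x`. If `Re e(0) ≤ 0`, this happens
for a set of `ε` accumulating at `0`, and the coefficient vanishes identically by the identity
theorem (`Combination.re_pos_of_integrable`).

*Sufficiency.* Choose a monomial in each polynomial. The `x` at which all these monomials are
dominant form a cone with finitely many integral generators `ρ_k` (`exists_generators`), and
finitely many such cones cover `ℝⁿ`. On a cone, with `x = ∑ k, t_k ρ_k` and `λ_k = exp (-t_k)`, each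
Euler integrand is a monomial in the `λ_k` times a function that is holomorphic near `λ_k = 0` in
each variable separately. The terms of a combination may be large and cancel. To use the
cancellation, apply difference operators `u ↦ u(t + e_k) - m u(t)`: a suitable finite product of
them removes the low Taylor coefficients of every term, so that each term becomes
`O (∏ k, λ_k ^ δ)` by the Schwarz lemma (`norm_dilation_sub_le`). Along each single direction `ρ_k`
the combination decays, by the tropical condition, and on functions with this property the
difference operators can be inverted without loss (`norm_le_of_norm_foldl_diffOp_le`). So the
combination itself is `O (∏ k, λ_k ^ δ)`, uniformly in small `ε`
(`Combination.exists_norm_eval_cone_le`), and it is dominated by an integrable function. Only the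
conditions at the generators `ρ_k` enter here. Differentiation under the integral sign concludes.
-/

open Asymptotics
open scoped NNReal

namespace Euler

/-! ### Dilation differences of holomorphic functions -/

/-- The union of the open disc of radius `r` about `0` and the real interval `[0, 1]`. -/
def discInterval (r : ℝ) : Set ℂ := Metric.ball 0 r ∪ (fun x : ℝ => (x : ℂ)) '' Set.Icc 0 1

theorem mul_mem_discInterval {r q : ℝ} (hq0 : 0 ≤ q) (hq1 : q ≤ 1) {z : ℂ}
    (hz : z ∈ discInterval r) : (q : ℂ) * z ∈ discInterval r := by
  rcases hz with hz | ⟨x, hx, rfl⟩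
  · left
    rw [mem_ball_zero_iff] at hz ⊢
    rw [norm_mul, Complex.norm_real, Real.norm_of_nonneg hq0]
    exact (mul_le_of_le_one_left (norm_nonneg _) hq1).trans_lt hz
  · right
    exact ⟨q * x, ⟨mul_nonneg hq0 hx.1, mul_le_one₀ hq1 hx.1 hx.2⟩, by push_cast; rfl⟩

theorem norm_le_one_of_mem_discInterval {r : ℝ} (hr1 : r ≤ 1) {z : ℂ}
    (hz : z ∈ discInterval r) : ‖z‖ ≤ 1 := by
  rcases hz with hz | ⟨x, hx, rfl⟩
  · exact (mem_ball_zero_iff.1 hz).le.trans hr1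
  · rw [Complex.norm_real, Real.norm_of_nonneg hx.1]
    exact hx.2

/-- If `g` vanishes to order `j` at `0`, then `g (q z) - q ^ j g z` vanishes to order `j + 1`,
because the dilation multiplies the leading monomial by `q ^ j`; the bound comes from the Schwarz
lemma applied to `g z / z ^ j`. -/
theorem norm_dilation_sub_le {g : ℂ → ℂ} {r A q : ℝ} {j : ℕ} (hr : 0 < r) (hq0 : 0 < q)
    (hq1 : q ≤ 1) (hg : DifferentiableOn ℂ g (Metric.ball 0 r))
    (hA : ∀ z ∈ discInterval r, ‖g z‖ ≤ A * ‖z‖ ^ j) {z : ℂ} (hz : z ∈ discInterval r) :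
    ‖g (q * z) - q ^ j * g z‖ ≤ 2 * A / r * ‖z‖ ^ (j + 1) := by
  have hqz := mul_mem_discInterval hq0.le hq1 hz
  have hA0 : 0 ≤ A := by
    have h1 : ((r / 2 : ℝ) : ℂ) ∈ discInterval r := by
      left
      rw [mem_ball_zero_iff, Complex.norm_real, Real.norm_of_nonneg (by positivity)]
      linarith
    have h2 := (norm_nonneg _).trans (hA _ h1)
    rw [Complex.norm_real, Real.norm_of_nonneg (by positivity)] at h2
    exact nonneg_of_mul_nonneg_left h2 (by positivity)
  have hqj : ‖(q : ℂ) ^ j‖ ≤ 1 := by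
    rw [norm_pow, Complex.norm_real, Real.norm_of_nonneg hq0.le]
    exact pow_le_one₀ hq0.le hq1
  rcases lt_or_ge ‖z‖ r with hzr | hzr
  · -- `G` is `g w / w ^ j` with the removable singularity at `0` filled in
    set G : ℂ → ℂ := Function.update (fun w => g w / w ^ j) 0
      (limUnder (𝓝[≠] 0) fun w => g w / w ^ j) with hG
    have hGne : ∀ w, w ≠ 0 → G w = g w / w ^ j := fun w hw => Function.update_of_ne hw _ _
    have hbd : ∀ w ∈ Metric.ball (0 : ℂ) r, w ≠ 0 → ‖g w / w ^ j‖ ≤ A := by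
      intro w hw hw0
      have : 0 < ‖w‖ ^ j := pow_pos (norm_pos_iff.2 hw0) _
      rw [norm_div, norm_pow, div_le_iff₀ this]
      exact hA w (Or.inl hw)
    have hGd : DifferentiableOn ℂ G (Metric.ball 0 r) := by
      refine Complex.differentiableOn_update_limUnder_of_bddAbove (Metric.ball_mem_nhds _ hr) ?_ ?_
      · refine (hg.mono Set.sdiff_subset).div (by fun_prop) ?_
        intro w hw
        exact pow_ne_zero _ hw.2
      · refine ⟨A, ?_⟩
        rintro _ ⟨w, hw, rfl⟩
        exact hbd w hw.1 hw.2
    by_cases hz0 : z = 0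
    · subst hz0
      rcases Nat.eq_zero_or_pos j with rfl | hj
      · simp
      · have := hA 0 (Or.inl (Metric.mem_ball_self hr))
        simp [hj.ne'] at this
        simp [this]
    · have hball : ∀ w ∈ Metric.ball (0 : ℂ) r, (q : ℂ) * w ∈ Metric.ball (0 : ℂ) r := by
        intro w hw
        rw [mem_ball_zero_iff] at hw ⊢
        rw [norm_mul, Complex.norm_real, Real.norm_of_nonneg hq0.le]
        exact (mul_le_of_le_one_left (norm_nonneg _) hq1).trans_lt hw
      have hq0' : (q : ℂ) ≠ 0 := by exact_mod_cast hq0.ne'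
      have hhd : DifferentiableOn ℂ (fun w => G (q * w) - G w) (Metric.ball 0 r) :=
        (hGd.comp (by fun_prop) hball).sub hGd
      have hmaps : Set.MapsTo (fun w => G (q * w) - G w) (Metric.ball 0 r)
          (Metric.closedBall ((fun w => G (q * w) - G w) 0) (2 * A)) := by
        intro w hw
        simp only [mul_zero, sub_self, mem_closedBall_zero_iff]
        by_cases hw0 : w = 0
        · subst hw0; simpa using hA0
        · rw [hGne _ hw0, hGne _ (mul_ne_zero hq0' hw0)]
          refine (norm_sub_le _ _).trans ?_
          linarith [hbd w hw hw0, hbd _ (hball w hw) (mul_ne_zero hq0' hw0)]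
      have hs := Complex.dist_le_div_mul_dist_of_mapsTo_ball hhd hmaps
        (mem_ball_zero_iff.2 hzr)
      simp only [mul_zero, sub_self, dist_zero_right] at hs
      have hzj : z ^ j ≠ 0 := pow_ne_zero _ hz0
      have : g (q * z) - q ^ j * g z = q ^ j * z ^ j * (G (q * z) - G z) := by
        rw [hGne _ hz0, hGne _ (mul_ne_zero hq0' hz0), mul_pow]
        field_simp
      rw [this, norm_mul, norm_mul, norm_pow z, pow_succ]
      calc _ ≤ 1 * ‖z‖ ^ j * (2 * A / r * ‖z‖) := by gcongr
        _ = _ := by ring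
  have hqn : ‖(q : ℂ) * z‖ ≤ ‖z‖ := by
    rw [norm_mul, Complex.norm_real, Real.norm_of_nonneg hq0.le]
    exact mul_le_of_le_one_left (norm_nonneg _) hq1
  · have h1 : ‖g (q * z)‖ ≤ A * ‖z‖ ^ j := (hA _ hqz).trans (by gcongr)
    have h2 : ‖(q : ℂ) ^ j * g z‖ ≤ A * ‖z‖ ^ j := by
      rw [norm_mul]
      exact (mul_le_of_le_one_left (norm_nonneg _) hqj).trans (hA _ hz)
    calc _ ≤ A * ‖z‖ ^ j + A * ‖z‖ ^ j := (norm_sub_le _ _).trans (add_le_add h1 h2)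
      _ = 2 * A / r * (‖z‖ ^ j * r) := by field_simp; ring
      _ ≤ 2 * A / r * (‖z‖ ^ j * ‖z‖) := by gcongr
      _ = _ := by rw [pow_succ]

/-! ### Inversion of difference operators -/

section Inversion

variable {Ω ι : Type*}

/-- The difference operator `u ↦ u ∘ τ_k - m u`, for a family of maps `τ_k`. -/
def diffOp (τ : ι → Ω → Ω) (p : ι × ℂ) (u : Ω → ℂ) : Ω → ℂ :=
  fun ω => u (τ p.1 ω) - p.2 * u ω

/-- If `u ∘ τ - m u` is small, then so is `u`, provided that `u` decays along the orbits of `τ`: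
`u = -∑ j, m ^ (-j - 1) (u ∘ τ - m u) ∘ τ ^ j`. -/
theorem norm_le_of_norm_diffOp_le {τ : Ω → Ω} {W : Ω → ℝ} {θ μ C : ℝ} {m : ℂ} {u : Ω → ℂ}
    (hθ : 0 ≤ θ) (hμ : θ < μ) (hm : μ ≤ ‖m‖) (hW : ∀ ω, W (τ ω) ≤ θ * W ω) (hC : 0 ≤ C)
    (hW0 : ∀ ω, 0 ≤ W ω)
    (hd : ∀ ω, ‖u (τ ω) - m * u ω‖ ≤ C * W ω)
    (hu : ∀ ω, ∃ K, ∀ j : ℕ, ‖u (τ^[j] ω)‖ ≤ K * θ ^ j) (ω : Ω) :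
    ‖u ω‖ ≤ C / (μ - θ) * W ω := by
  have hμ0 : 0 < μ := hθ.trans_lt hμ
  have step : ∀ ω, ‖u ω‖ ≤ μ⁻¹ * (‖u (τ ω)‖ + C * W ω) := by
    intro ω
    have h1 : ‖m‖ * ‖u ω‖ ≤ ‖u (τ ω)‖ + C * W ω := by
      rw [← norm_mul]
      have : m * u ω = u (τ ω) - (u (τ ω) - m * u ω) := by ring
      rw [this]
      exact (norm_sub_le _ _).trans (by linarith [hd ω])
    rw [inv_mul_eq_div, le_div_iff₀ hμ0, mul_comm]
    exact (mul_le_mul_of_nonneg_right hm (norm_nonneg _)).trans h1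
  have key : ∀ J : ℕ, ∀ ω, ‖u ω‖ ≤ (μ⁻¹) ^ J * ‖u (τ^[J] ω)‖ + C / (μ - θ) * W ω := by
    intro J
    induction J with
    | zero =>
      intro ω
      have : 0 ≤ C / (μ - θ) * W ω := mul_nonneg (div_nonneg hC (by linarith)) (hW0 ω)
      simpa using this
    | succ J ih =>
      intro ω
      have hpos : 0 < μ - θ := by linarith
      calc ‖u ω‖ ≤ μ⁻¹ * (‖u (τ ω)‖ + C * W ω) := step ω
        _ ≤ μ⁻¹ * (((μ⁻¹) ^ J * ‖u (τ^[J] (τ ω))‖ + C / (μ - θ) * (θ * W ω)) + C * W ω) := by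
          gcongr
          exact (ih (τ ω)).trans (by gcongr; exact hW ω)
        _ = _ := by
          rw [Function.iterate_succ_apply, pow_succ]
          field_simp
          ring
  obtain ⟨K, hK⟩ := hu ω
  have hlim : Tendsto (fun J : ℕ => K * (θ / μ) ^ J + C / (μ - θ) * W ω) atTop
      (𝓝 (K * 0 + C / (μ - θ) * W ω)) := by
    refine ((tendsto_pow_atTop_nhds_zero_of_lt_one (by positivity) ?_).const_mul K).add_const _
    rw [div_lt_one hμ0]
    exact hμ
  rw [mul_zero, zero_add] at hlim
  refine ge_of_tendsto' hlim fun J => (key J ω).trans ?_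
  refine add_le_add ?_ le_rfl
  calc _ ≤ (μ⁻¹) ^ J * (K * θ ^ J) := by gcongr; exact hK J
    _ = _ := by rw [div_pow, inv_pow]; ring

/-- A function that decays along each direction `τ_k` separately is bounded by a joint weight `W`
as soon as a composition of difference operators maps it to a function with such a bound. The
constant does not depend on the function. -/
theorem norm_le_of_norm_foldl_diffOp_le {τ : ι → Ω → Ω} (hcomm : ∀ k l ω, τ k (τ l ω) = τ l (τ k ω))
    {W : Ω → ℝ} {θ μ : ℝ} (hθ : 0 ≤ θ) (hμ : θ < μ) (hW : ∀ k ω, W (τ k ω) ≤ θ * W ω)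
    (hW0 : ∀ ω, 0 ≤ W ω) (l : List (ι × ℂ)) :
    ∀ {C : ℝ} (_ : 0 ≤ C) {u : Ω → ℂ}, (∀ p ∈ l, μ ≤ ‖p.2‖) →
    (∀ k ω, ∃ K, ∀ j : ℕ, ‖u ((τ k)^[j] ω)‖ ≤ K * θ ^ j) →
    (∀ ω, ‖l.foldl (fun v p => diffOp τ p v) u ω‖ ≤ C * W ω) →
    ∀ ω, ‖u ω‖ ≤ C / (μ - θ) ^ l.length * W ω := by
  induction l with
  | nil => intro C hC u _ _ h ω; simpa using h ω
  | cons p l ih =>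
    intro C hC u hl hu h ω
    have hpos : 0 < μ - θ := by linarith
    have h1 := ih hC (u := diffOp τ p u) (fun p' hp' => hl p' (List.mem_cons_of_mem _ hp')) (by
      intro k ω
      obtain ⟨K1, hK1⟩ := hu k (τ p.1 ω)
      obtain ⟨K2, hK2⟩ := hu k ω
      refine ⟨K1 + ‖p.2‖ * K2, fun j => ?_⟩
      have hc : τ p.1 ((τ k)^[j] ω) = (τ k)^[j] (τ p.1 ω) :=
        Function.Commute.iterate_right (f := τ p.1) (g := τ k) (fun ω => hcomm _ _ _) j ω
      unfold diffOp
      rw [hc]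
      refine (norm_sub_le _ _).trans ?_
      rw [norm_mul, add_mul, mul_assoc]
      exact add_le_add (hK1 j) (mul_le_mul_of_nonneg_left (hK2 j) (norm_nonneg _))) h
    have h2 := norm_le_of_norm_diffOp_le (τ := τ p.1) (m := p.2) hθ hμ (hl p List.mem_cons_self)
      (hW p.1) (C := C / (μ - θ) ^ l.length) (by positivity) hW0 h1 (hu p.1) ω
    refine h2.trans_eq ?_
    rw [List.length_cons, pow_succ, div_div]

end Inversion

/-! ### Integrable exponential sums -/

/-- For distinct complex numbers some real translation separates the exponentials. -/
theorem exists_pos_exp_mul_ne {z w : ℂ} (h : z ≠ w) :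
    ∃ s : ℝ, 0 < s ∧ Complex.exp (z * s) ≠ Complex.exp (w * s) := by
  have hd : 0 < ‖z - w‖ := norm_pos_iff.2 (sub_ne_zero.2 h)
  -- with this `s` the difference `(z - w) s` has modulus `1 < 2 π`
  refine ⟨1 / ‖z - w‖, by positivity, fun he => ?_⟩
  obtain ⟨k, hk⟩ := Complex.exp_eq_exp_iff_exists_int.1 he
  have h1 : (z - w) * ((1 / ‖z - w‖ : ℝ) : ℂ) = k * (2 * Real.pi * Complex.I) := by
    rw [sub_mul, hk]; ring
  have h2 := congrArg norm h1
  rw [norm_mul, Complex.norm_real, Real.norm_of_nonneg (by positivity), mul_one_div,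
    div_self hd.ne', norm_mul, norm_mul, norm_mul, Complex.norm_I] at h2
  simp only [Complex.norm_intCast, Complex.norm_ofNat, Complex.norm_real, mul_one,
    Real.norm_of_nonneg Real.pi_pos.le] at h2
  have hpi := Real.pi_gt_three
  rcases eq_or_ne k 0 with rfl | hk0
  · simp at h2
  · have : (1 : ℝ) ≤ |(k : ℝ)| := by exact_mod_cast Int.one_le_abs hk0
    nlinarith

/-- An exponential sum that is integrable at `+∞` contains no exponential with non-negative real
part of the exponent. The other exponentials are eliminated by translations. -/
theorem coeff_eq_zero_of_integrableOn_sum_exp {ι : Type*} (s : Finset ι) {z : ι → ℂ} {z₀ : ℂ}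
    (hz₀ : 0 ≤ z₀.re) (hz : ∀ i ∈ s, z i ≠ z₀) : ∀ (c : ι → ℂ) (c₀ : ℂ),
    IntegrableOn (fun t : ℝ => c₀ * Complex.exp (z₀ * t) + ∑ i ∈ s, c i * Complex.exp (z i * t))
      (Set.Ioi 0) → c₀ = 0 := by
  classical
  induction s using Finset.induction_on with
  | empty =>
    intro c c₀ h
    simp only [Finset.sum_empty, add_zero] at h
    have h1 : IntegrableOn (fun _ : ℝ => c₀) (Set.Ioi 0) := by
      refine Integrable.mono h aestronglyMeasurable_const ?_
      filter_upwards [ae_restrict_mem measurableSet_Ioi] with t ht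
      rw [norm_mul, Complex.norm_exp]
      refine le_mul_of_one_le_right (norm_nonneg _) (Real.one_le_exp ?_)
      simpa using mul_nonneg hz₀ (le_of_lt ht)
    rw [integrableOn_const_iff] at h1
    simpa using h1
  | insert a s ha ih =>
    intro c c₀ h
    obtain ⟨σ, hσ, hne⟩ := exists_pos_exp_mul_ne (hz a (Finset.mem_insert_self _ _))
    set f : ℝ → ℂ := fun t => c₀ * Complex.exp (z₀ * t) +
      ∑ i ∈ insert a s, c i * Complex.exp (z i * t) with hf
    -- `f (t + σ) - exp (z a σ) f t` has no exponential with exponent `z a`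
    have hshift : IntegrableOn (fun t => f (t + σ)) (Set.Ioi 0) := by
      have h1 : IntegrableOn f (Set.Ioi σ) := h.mono_set (Set.Ioi_subset_Ioi hσ.le)
      have h2 := (measurePreserving_add_right volume σ).integrableOn_comp_preimage
        (MeasurableEquiv.addRight σ).measurableEmbedding (f := f) (s := Set.Ioi σ)
      have h3 : (fun x : ℝ => x + σ) ⁻¹' Set.Ioi σ = Set.Ioi 0 := by ext x; simp
      rw [h3] at h2
      exact h2.2 h1
    have h4 := hshift.sub (h.const_mul (Complex.exp (z a * σ)))
    have h5 := ih (fun i hi => hz i (Finset.mem_insert_of_mem hi))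
      (fun i => c i * (Complex.exp (z i * σ) - Complex.exp (z a * σ)))
      (c₀ * (Complex.exp (z₀ * σ) - Complex.exp (z a * σ))) (by
        refine h4.congr (Eventually.of_forall fun t => ?_)
        have hexp : ∀ w : ℂ, Complex.exp (w * ((t + σ : ℝ) : ℂ)) =
            Complex.exp (w * t) * Complex.exp (w * σ) := by
          intro w
          rw [← Complex.exp_add]; push_cast; ring_nf
        simp only [hf, Pi.sub_apply, hexp, Finset.sum_insert ha]
        have : ∑ i ∈ s, c i * (Complex.exp (z i * σ) - Complex.exp (z a * σ)) *
            Complex.exp (z i * t) = ∑ i ∈ s, c i * (Complex.exp (z i * t) * Complex.exp (z i * σ)) -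
            Complex.exp (z a * σ) * ∑ i ∈ s, c i * Complex.exp (z i * t) := by
          rw [Finset.mul_sum, ← Finset.sum_sub_distrib]
          exact Finset.sum_congr rfl fun i _ => by ring
        rw [this]
        ring)
    exact (mul_eq_zero.1 h5).resolve_right (sub_ne_zero.2 hne.symm)

/-! ### Integrals depending on a complex parameter -/

section Parameter

variable {A : Type*} [MeasurableSpace A] {μ : Measure A}

theorem aestronglyMeasurable_deriv_param {f : A → ℂ → ℂ} (hf : ∀ a, Differentiable ℂ (f a))
    (hm : ∀ ε, AEStronglyMeasurable (fun a => f a ε) μ) (ε : ℂ) :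
    AEStronglyMeasurable (fun a => deriv (f a) ε) μ := by
  have h0 : Tendsto (fun j : ℕ => (1 / ((j : ℂ) + 1))) atTop (𝓝[≠] 0) := by
    refine tendsto_nhdsWithin_iff.2 ⟨tendsto_one_div_add_atTop_nhds_zero_nat, ?_⟩
    exact Eventually.of_forall fun j => one_div_ne_zero (Nat.cast_add_one_ne_zero j)
  refine aestronglyMeasurable_of_tendsto_ae (u := atTop)
    (f := fun (j : ℕ) a => (1 / ((j : ℂ) + 1))⁻¹ • (f a (ε + 1 / ((j : ℂ) + 1)) - f a ε))
    (fun j => ((hm (ε + 1 / ((j : ℂ) + 1))).sub (hm ε)).const_smul (1 / ((j : ℂ) + 1))⁻¹) ?_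
  refine Eventually.of_forall fun a => ?_
  exact (hasDerivAt_iff_tendsto_slope_zero.1 (hf a ε).hasDerivAt).comp h0

theorem hasDerivAt_integral_of_dominated_of_differentiable {f : A → ℂ → ℂ} {r : ℝ} {G : A → ℝ}
    (hf : ∀ a, Differentiable ℂ (f a))
    (hm : ∀ ε, AEStronglyMeasurable (fun a => f a ε) μ) (hG : Integrable G μ)
    (hb : ∀ᵐ a ∂μ, ∀ ε ∈ Metric.ball (0 : ℂ) r, ‖f a ε‖ ≤ G a) {ε : ℂ}
    (hε : ε ∈ Metric.ball (0 : ℂ) r) :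
    HasDerivAt (fun ε => ∫ a, f a ε ∂μ) (∫ a, deriv (f a) ε ∂μ) ε := by
  obtain ⟨R, hR0, hR⟩ : ∃ R > 0, ‖ε‖ + 2 * R < r := by
    rw [mem_ball_zero_iff] at hε
    exact ⟨(r - ‖ε‖) / 3, by linarith, by linarith⟩
  refine (hasDerivAt_integral_of_dominated_loc_of_deriv_le (F := fun ε a => f a ε)
    (F' := fun ε a => deriv (f a) ε) (bound := fun a => G a / R)
    (Metric.ball_mem_nhds ε hR0) (Eventually.of_forall hm) ?_
    (aestronglyMeasurable_deriv_param hf hm ε) ?_ (hG.div_const R)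
    (Eventually.of_forall fun a x _ => (hf a x).hasDerivAt)).2
  · exact hG.mono' (hm ε) (hb.mono fun a ha => ha ε hε)
  · filter_upwards [hb] with a ha x hx
    refine Complex.norm_deriv_le_of_forall_mem_sphere_norm_le hR0 (hf a).diffContOnCl ?_
    intro z hz
    refine ha z ?_
    rw [mem_ball_zero_iff]
    have h1 : ‖z - x‖ = R := by simpa [dist_eq_norm] using hz
    have h2 : ‖x - ε‖ < R := by simpa [dist_eq_norm] using hx
    calc ‖z‖ = ‖(z - x) + (x - ε) + ε‖ := by ring_nf
      _ ≤ ‖z - x‖ + ‖x - ε‖ + ‖ε‖ := norm_add₃_le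
      _ < r := by linarith

/-- A holomorphic family of functions that is dominated by an integrable function near `0` can be
differentiated under the integral sign any number of times. The domination passes to the
derivative by the Cauchy estimate. -/
theorem iteratedDeriv_integral_of_dominated (k : ℕ) :
    ∀ {f : A → ℂ → ℂ} {r : ℝ} {G : A → ℝ}, 0 < r → (∀ a, Differentiable ℂ (f a)) →
    (∀ ε, AEStronglyMeasurable (fun a => f a ε) μ) → Integrable G μ →
    (∀ᵐ a ∂μ, ∀ ε ∈ Metric.ball (0 : ℂ) r, ‖f a ε‖ ≤ G a) →
    Integrable (fun a => iteratedDeriv k (f a) 0) μ ∧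
    iteratedDeriv k (fun ε => ∫ a, f a ε ∂μ) 0 = ∫ a, iteratedDeriv k (f a) 0 ∂μ := by
  induction k with
  | zero =>
    intro f r G hr hf hm hG hb
    simp only [iteratedDeriv_zero, and_true]
    exact hG.mono' (hm 0) (hb.mono fun a ha => ha 0 (Metric.mem_ball_self hr))
  | succ k ih =>
    intro f r G hr hf hm hG hb
    have h1 := ih (f := fun a => deriv (f a)) (r := r / 2) (G := fun a => G a / (r / 2))
      (by positivity) (fun a => (hf a).contDiff.differentiable_deriv_two)
      (aestronglyMeasurable_deriv_param hf hm) (hG.div_const _) (by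
        filter_upwards [hb] with a ha ε hε
        refine Complex.norm_deriv_le_of_forall_mem_sphere_norm_le (by positivity)
          (hf a).diffContOnCl fun z hz => ha z ?_
        rw [mem_ball_zero_iff] at hε ⊢
        have h1 : ‖z - ε‖ = r / 2 := by simpa [dist_eq_norm] using hz
        calc ‖z‖ = ‖(z - ε) + ε‖ := by ring_nf
          _ ≤ ‖z - ε‖ + ‖ε‖ := norm_add_le _ _
          _ < r := by linarith)
    simp only [iteratedDeriv_succ']
    refine ⟨h1.1, ?_⟩
    rw [← h1.2]
    refine Filter.EventuallyEq.iteratedDeriv_eq k ?_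
    filter_upwards [Metric.ball_mem_nhds (0 : ℂ) hr] with ε hε
    exact (hasDerivAt_integral_of_dominated_of_differentiable hf hm hG hb hε).deriv

end Parameter

/-! ### Logarithmic coordinates -/

/-- Componentwise exponential. -/
noncomputable def expMap {n : ℕ} (x : Fin n → ℝ) : Fin n → ℝ := fun i => Real.exp (x i)

theorem measurable_expMap {n : ℕ} : Measurable (expMap (n := n)) := by
  unfold expMap; fun_prop

theorem continuous_expMap {n : ℕ} : Continuous (expMap (n := n)) := by
  unfold expMap; fun_prop

theorem expMap_injective {n : ℕ} : Function.Injective (expMap (n := n)) := fun _ _ h =>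
  funext fun i => Real.exp_injective (congrFun h i)

theorem expMap_log {n : ℕ} {α : Fin n → ℝ} (hα : ∀ i, 0 < α i) :
    expMap (fun i => Real.log (α i)) = α := funext fun i => Real.exp_log (hα i)

theorem range_expMap {n : ℕ} : Set.range (expMap (n := n)) = {α | ∀ i, 0 < α i} := by
  ext α
  constructor
  · rintro ⟨x, rfl⟩ i; exact Real.exp_pos _
  · exact fun h => ⟨_, expMap_log h⟩

theorem measurableEmbedding_expMap {n : ℕ} : MeasurableEmbedding (expMap (n := n)) :=
  continuous_expMap.measurableEmbedding expMap_injective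

/-- In logarithmic coordinates `dα / α` is the Lebesgue measure. -/
theorem canonicalMeasure_eq_map (n : ℕ) :
    canonicalMeasure n = Measure.map (expMap (n := n)) volume := by
  have hderiv : ∀ x : Fin n → ℝ, HasFDerivAt (expMap (n := n))
      (ContinuousLinearMap.pi fun i => (Real.exp (x i)) •
        (ContinuousLinearMap.proj i : (Fin n → ℝ) →L[ℝ] ℝ)) x := by
    intro x
    rw [hasFDerivAt_pi]
    intro i
    exact (hasFDerivAt_apply i x).exp
  have hdet : ∀ x : Fin n → ℝ, (ContinuousLinearMap.pi fun i => (Real.exp (x i)) •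
        (ContinuousLinearMap.proj i : (Fin n → ℝ) →L[ℝ] ℝ)).det = ∏ i, Real.exp (x i) := by
    intro x
    have h1 : ((ContinuousLinearMap.pi fun i => (Real.exp (x i)) •
        (ContinuousLinearMap.proj i : (Fin n → ℝ) →L[ℝ] ℝ)) : (Fin n → ℝ) →ₗ[ℝ] (Fin n → ℝ)) =
        Matrix.toLin' (Matrix.diagonal fun i => Real.exp (x i)) := by
      ext v i
      simp [Matrix.mulVec_diagonal, Pi.single_apply]
    rw [ContinuousLinearMap.det, h1, LinearMap.det_toLin', Matrix.det_diagonal]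
  ext s hs
  have hpos : MeasurableSet {α : Fin n → ℝ | ∀ i, 0 < α i} := by
    rw [← range_expMap]; exact measurableEmbedding_expMap.measurableSet_range
  have hmeas : Measurable fun α : Fin n → ℝ => ENNReal.ofReal (∏ i, (α i)⁻¹) := by fun_prop
  rw [canonicalMeasure, withDensity_apply _ hs, Measure.restrict_restrict hs,
    Measure.map_apply measurable_expMap hs]
  have himg : s ∩ {α : Fin n → ℝ | ∀ i, 0 < α i} = expMap '' (expMap ⁻¹' s) := by
    rw [Set.image_preimage_eq_inter_range, range_expMap]
  rw [himg, lintegral_image_eq_lintegral_abs_det_fderiv_mul volume (measurable_expMap hs)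
    (fun x _ => (hderiv x).hasFDerivWithinAt) expMap_injective.injOn]
  rw [← setLIntegral_one]
  refine lintegral_congr fun x => ?_
  rw [hdet, ← ENNReal.ofReal_mul (abs_nonneg _), abs_of_nonneg (by positivity)]
  simp only [expMap, ← Finset.prod_mul_distrib]
  simp [Real.exp_ne_zero]

theorem integrable_exp_neg_mul_abs {δ : ℝ} (hδ : 0 < δ) :
    Integrable fun x : ℝ => Real.exp (-(δ * |x|)) := by
  rw [← integrableOn_univ, ← Set.Iic_union_Ioi (a := (0 : ℝ)), integrableOn_union]
  constructor
  · refine (integrableOn_exp_mul_Iic hδ 0).congr_fun (fun x hx => ?_) measurableSet_Iic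
    simp only [abs_of_nonpos (Set.mem_Iic.1 hx)]
    ring_nf
  · refine (exp_neg_integrableOn_Ioi 0 hδ).congr_fun (fun x hx => ?_) measurableSet_Ioi
    simp only [abs_of_pos (Set.mem_Ioi.1 hx)]
    ring_nf

/-- By Tonelli's theorem, a continuous integrable function on `ℝⁿ` is integrable on almost every
half-line in a given direction. -/
theorem ae_integrableOn_ray {n : ℕ} {f : (Fin n → ℝ) → ℂ} (hc : Continuous f)
    (hf : Integrable f) {ρ : Fin n → ℝ} (hρ : ρ ≠ 0) :
    ∀ᵐ x : Fin n → ℝ, IntegrableOn (fun t : ℝ => f (x + t • ρ)) (Set.Ioi 0) := by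
  obtain ⟨i, hi⟩ : ∃ i, ρ i ≠ 0 := Function.ne_iff.1 hρ
  let B : ℕ → Set (Fin n → ℝ) := fun N => {x | |x i| ≤ N}
  have hB : ∀ N, MeasurableSet (B N) := fun N => measurableSet_le (by fun_prop) measurable_const
  have hF : Measurable fun x => ‖f x‖ₑ := hc.measurable.enorm
  -- the ray through `y` in direction `ρ` meets the slab `B N` in an interval of length
  -- `2 N / |ρ i|`
  have hlin : ∀ N, ∫⁻ x, ∫⁻ t : ℝ, (B N).indicator 1 x * ‖f (x + t • ρ)‖ₑ ≠ ⊤ := by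
    intro N
    have h1 : Measurable (Function.uncurry fun (x : Fin n → ℝ) (t : ℝ) =>
        (B N).indicator (1 : (Fin n → ℝ) → ENNReal) x * ‖f (x + t • ρ)‖ₑ) := by
      refine Measurable.mul ?_ ?_
      · exact (measurable_one.indicator (hB N)).comp measurable_fst
      · exact hF.comp (by fun_prop)
    have h2 : Measurable (Function.uncurry fun (t : ℝ) (y : Fin n → ℝ) =>
        (B N).indicator (1 : (Fin n → ℝ) → ENNReal) (y - t • ρ) * ‖f y‖ₑ) := by
      refine Measurable.mul ?_ ?_
      · exact (measurable_one.indicator (hB N)).comp (by fun_prop)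
      · exact hF.comp (by fun_prop)
    rw [lintegral_lintegral_swap h1.aemeasurable]
    have h3 : ∀ t : ℝ, ∫⁻ x, (B N).indicator 1 x * ‖f (x + t • ρ)‖ₑ =
        ∫⁻ y, (B N).indicator 1 (y - t • ρ) * ‖f y‖ₑ := by
      intro t
      rw [← lintegral_add_right_eq_self
        (fun y => (B N).indicator 1 (y - t • ρ) * ‖f y‖ₑ) (t • ρ)]
      simp only [add_sub_cancel_right]
    simp only [h3]
    rw [lintegral_lintegral_swap h2.aemeasurable]
    have h4 : ∀ y, ∫⁻ t : ℝ, (B N).indicator 1 (y - t • ρ) * ‖f y‖ₑ ≤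
        ENNReal.ofReal (2 * N / |ρ i|) * ‖f y‖ₑ := by
      intro y
      rw [lintegral_mul_const _ (show Measurable fun t : ℝ =>
        (B N).indicator (1 : (Fin n → ℝ) → ENNReal) (y - t • ρ) from
        (measurable_one.indicator (hB N)).comp (by fun_prop))]
      gcongr
      have hsub : ∀ t : ℝ, (B N).indicator (1 : (Fin n → ℝ) → ENNReal) (y - t • ρ) ≤
          (Metric.closedBall (y i / ρ i) (N / |ρ i|)).indicator 1 t := by
        intro t
        by_cases hmem : y - t • ρ ∈ B N
        · have hmem' : t ∈ Metric.closedBall (y i / ρ i) (N / |ρ i|) := by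
            have h5 : |y i - t * ρ i| ≤ N := hmem
            rw [Metric.mem_closedBall, Real.dist_eq, abs_sub_comm, le_div_iff₀ (abs_pos.2 hi),
              ← abs_mul]
            rwa [sub_mul, div_mul_cancel₀ _ hi]
          rw [Set.indicator_of_mem hmem, Set.indicator_of_mem hmem']
          simp
        · rw [Set.indicator_of_notMem hmem]
          exact zero_le
      refine (lintegral_mono hsub).trans ?_
      rw [lintegral_indicator_one Metric.isClosed_closedBall.measurableSet, Real.volume_closedBall]
      rw [mul_div_assoc]
    refine ne_of_lt ((lintegral_mono h4).trans_lt ?_)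
    rw [lintegral_const_mul _ hF]
    exact ENNReal.mul_lt_top ENNReal.ofReal_lt_top hf.2
  have hae : ∀ N, ∀ᵐ x : Fin n → ℝ, ∫⁻ t : ℝ, (B N).indicator 1 x * ‖f (x + t • ρ)‖ₑ < ⊤ := by
    intro N
    refine ae_lt_top ?_ (hlin N)
    refine Measurable.lintegral_prod_right' (f := fun p : (Fin n → ℝ) × ℝ =>
      (B N).indicator (1 : (Fin n → ℝ) → ENNReal) p.1 * ‖f (p.1 + p.2 • ρ)‖ₑ) ?_
    refine Measurable.mul ?_ ?_
    · exact (measurable_one.indicator (hB N)).comp measurable_fst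
    · exact hF.comp (by fun_prop)
  filter_upwards [ae_all_iff.2 hae] with x hx
  obtain ⟨N, hN⟩ := exists_nat_ge |x i|
  have hxN := hx N
  simp only [Set.indicator_of_mem (show x ∈ B N from hN), Pi.one_apply, one_mul] at hxN
  have hint : Integrable fun t : ℝ => f (x + t • ρ) :=
    ⟨(hc.comp (by fun_prop)).aestronglyMeasurable, hxN⟩
  exact hint.integrableOn

/-! ### Generators of rational polyhedral cones -/

/-- One step of Fourier–Motzkin elimination: the part of a finitely generated cone on which a
linear form `ℓ` is non-negative is generated by the generators with `ℓ ≥ 0` and by the combinations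
`ℓ(v) w - ℓ(w) v` with `ℓ(v) > 0 > ℓ(w)`, on which `ℓ` vanishes. -/
theorem mem_span_of_sum_nonneg {E K : Type*} [AddCommGroup E] [Module ℝ E] (V : Finset K)
    (c : K → E) (ℓ t : K → ℝ) (ht : ∀ v ∈ V, 0 ≤ t v) (h : 0 ≤ ∑ v ∈ V, t v * ℓ v)
    (S : Set E) (hS1 : ∀ v ∈ V, 0 ≤ ℓ v → c v ∈ S)
    (hS2 : ∀ v ∈ V, ∀ w ∈ V, 0 < ℓ v → ℓ w < 0 → ℓ v • c w - ℓ w • c v ∈ S) :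
    ∑ v ∈ V, t v • c v ∈ Submodule.span ℝ≥0 S := by
  classical
  have hsmul : ∀ (a : ℝ) (y : E), 0 ≤ a → y ∈ Submodule.span ℝ≥0 S →
      a • y ∈ Submodule.span ℝ≥0 S := fun a y ha hy =>
    (Submodule.span ℝ≥0 S).smul_mem ⟨a, ha⟩ hy
  set p := V.filter fun v => 0 < ℓ v with hp
  set q := V.filter fun v => ¬ 0 < ℓ v with hq
  set z := q.filter fun v => 0 ≤ ℓ v with hz
  set m := q.filter fun v => ¬ 0 ≤ ℓ v with hm
  have hpV : ∀ v ∈ p, v ∈ V ∧ 0 < ℓ v := fun v hv => Finset.mem_filter.1 hv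
  have hqV : ∀ v ∈ q, v ∈ V := fun v hv => (Finset.mem_filter.1 hv).1
  have hzV : ∀ v ∈ z, v ∈ V ∧ 0 ≤ ℓ v ∧ ℓ v ≤ 0 := fun v hv =>
    ⟨hqV v (Finset.mem_filter.1 hv).1, (Finset.mem_filter.1 hv).2,
      not_lt.1 (Finset.mem_filter.1 (Finset.mem_filter.1 hv).1).2⟩
  have hmV : ∀ v ∈ m, v ∈ V ∧ ℓ v < 0 := fun v hv =>
    ⟨hqV v (Finset.mem_filter.1 hv).1, not_le.1 (Finset.mem_filter.1 hv).2⟩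
  have split : ∑ v ∈ V, t v • c v =
      ∑ v ∈ p, t v • c v + (∑ v ∈ z, t v • c v + ∑ v ∈ m, t v • c v) := by
    rw [hz, hm, Finset.sum_filter_add_sum_filter_not, hp, hq, Finset.sum_filter_add_sum_filter_not]
  have split' : ∑ v ∈ V, t v * ℓ v =
      ∑ v ∈ p, t v * ℓ v + (∑ v ∈ z, t v * ℓ v + ∑ v ∈ m, t v * ℓ v) := by
    rw [hz, hm, Finset.sum_filter_add_sum_filter_not, hp, hq, Finset.sum_filter_add_sum_filter_not]
  have hzero : ∑ v ∈ z, t v * ℓ v = 0 := Finset.sum_eq_zero fun v hv => by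
    rw [le_antisymm (hzV v hv).2.2 (hzV v hv).2.1, mul_zero]
  set P := ∑ v ∈ p, t v * ℓ v with hP
  set N := ∑ v ∈ m, t v * ℓ v with hN
  have hPN : 0 ≤ P + N := by rw [split', hzero] at h; linarith
  have hN0 : N ≤ 0 := Finset.sum_nonpos fun v hv =>
    mul_nonpos_of_nonneg_of_nonpos (ht v (hmV v hv).1) (hmV v hv).2.le
  have hzmem : ∑ v ∈ z, t v • c v ∈ Submodule.span ℝ≥0 S := Submodule.sum_mem _ fun v hv =>
    hsmul _ _ (ht v (hzV v hv).1) (Submodule.subset_span (hS1 v (hzV v hv).1 (hzV v hv).2.1))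
  rw [split]
  rcases eq_or_lt_of_le (show 0 ≤ P by linarith) with hP0 | hP0
  · have hN' : N = 0 := by linarith
    have htm : ∀ v ∈ m, t v = 0 := by
      intro v hv
      have := (Finset.sum_eq_zero_iff_of_nonpos (fun v hv =>
        mul_nonpos_of_nonneg_of_nonpos (ht v (hmV v hv).1) (hmV v hv).2.le)).1 hN' v hv
      exact (mul_eq_zero.1 this).resolve_right (hmV v hv).2.ne
    have hm0 : ∑ v ∈ m, t v • c v = 0 := Finset.sum_eq_zero fun v hv => by
      rw [htm v hv, zero_smul]
    rw [hm0, add_zero]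
    refine Submodule.add_mem _ (Submodule.sum_mem _ fun v hv => ?_) hzmem
    exact hsmul _ _ (ht v (hpV v hv).1) (Submodule.subset_span (hS1 v (hpV v hv).1 (hpV v hv).2.le))
  · -- every generator with `ℓ < 0` is traded for combinations with the generators with `ℓ > 0`;
    -- the remaining coefficients `(1 + N / P) t_v` are non-negative since `P + N ≥ 0`
    have key : ∑ v ∈ p, t v • c v + ∑ w ∈ m, t w • c w =
        ∑ v ∈ p, ((1 + N / P) * t v) • c v +
          ∑ v ∈ p, ∑ w ∈ m, (t v * t w / P) • (ℓ v • c w - ℓ w • c v) := by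
      have h1 : ∑ v ∈ p, ∑ w ∈ m, (t v * t w / P) • (ℓ v • c w - ℓ w • c v) =
          ∑ v ∈ p, ((t v * ℓ v / P) • ∑ w ∈ m, t w • c w) - ∑ v ∈ p, (t v * N / P) • c v := by
        rw [← Finset.sum_sub_distrib]
        refine Finset.sum_congr rfl fun v _ => ?_
        rw [Finset.smul_sum, hN, Finset.mul_sum, Finset.sum_div, Finset.sum_smul,
          ← Finset.sum_sub_distrib]
        refine Finset.sum_congr rfl fun w _ => ?_
        rw [smul_sub, smul_smul, smul_smul, smul_smul]
        congr 2 <;> ring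
      have h2 : ∑ v ∈ p, t v * ℓ v / P = 1 := by
        rw [← Finset.sum_div, ← hP, div_self hP0.ne']
      rw [h1, ← Finset.sum_smul, h2, one_smul]
      have h3 : ∑ v ∈ p, ((1 + N / P) * t v) • c v =
          ∑ v ∈ p, t v • c v + ∑ v ∈ p, (t v * N / P) • c v := by
        rw [← Finset.sum_add_distrib]
        refine Finset.sum_congr rfl fun v _ => ?_
        rw [← add_smul]
        congr 1
        ring
      rw [h3]
      abel
    rw [add_left_comm, key]
    refine Submodule.add_mem _ hzmem (Submodule.add_mem _ (Submodule.sum_mem _ fun v hv => ?_)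
      (Submodule.sum_mem _ fun v hv => Submodule.sum_mem _ fun w hw => ?_))
    · refine hsmul _ _ (mul_nonneg ?_ (ht v (hpV v hv).1))
        (Submodule.subset_span (hS1 v (hpV v hv).1 (hpV v hv).2.le))
      rw [one_add_div hP0.ne']
      exact div_nonneg hPN hP0.le
    · exact hsmul _ _ (div_nonneg (mul_nonneg (ht v (hpV v hv).1) (ht w (hmV w hw).1)) hP0.le)
        (Submodule.subset_span (hS2 v (hpV v hv).1 w (hmV w hw).1 (hpV v hv).2 (hmV w hw).2))

/-- The real vector underlying an integer vector. -/
def toReal {n : ℕ} (v : Fin n → ℤ) : Fin n → ℝ := fun i => (v i : ℝ)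

theorem pairing_toReal {n : ℕ} (v m : Fin n → ℤ) :
    pairing (toReal v) m = ((∑ i, v i * m i : ℤ) : ℝ) := by
  simp [pairing, toReal]

theorem pairing_sub {n : ℕ} (ρ : Fin n → ℝ) (m m' : Fin n → ℤ) :
    pairing ρ (m - m') = pairing ρ m - pairing ρ m' := by
  simp [pairing, mul_sub, Finset.sum_sub_distrib]

theorem pairing_add_left {n : ℕ} (ρ ρ' : Fin n → ℝ) (m : Fin n → ℤ) :
    pairing (ρ + ρ') m = pairing ρ m + pairing ρ' m := by
  simp [pairing, add_mul, Finset.sum_add_distrib]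

theorem pairing_smul_left {n : ℕ} (t : ℝ) (ρ : Fin n → ℝ) (m : Fin n → ℤ) :
    pairing (t • ρ) m = t * pairing ρ m := by
  simp [pairing, mul_assoc, Finset.mul_sum]

theorem pairing_sum_left {n : ℕ} {K : Type*} (s : Finset K) (ρ : K → Fin n → ℝ) (m : Fin n → ℤ) :
    pairing (∑ k ∈ s, ρ k) m = ∑ k ∈ s, pairing (ρ k) m := by
  simp only [pairing, Finset.sum_apply, Finset.sum_mul]
  exact Finset.sum_comm

/-- A cone defined by finitely many integral linear inequalities is generated by finitely many
integral vectors. The proof imposes the inequalities one at a time, starting from `ℝⁿ`, which is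
generated by the vectors `± e_i`. -/
theorem exists_generators_aux {n : ℕ} (L : Finset (Fin n → ℤ)) :
    ∃ V : Finset (Fin n → ℤ), (∀ v ∈ V, ∀ m ∈ L, 0 ≤ pairing (toReal v) m) ∧
      ∀ x : Fin n → ℝ, (∀ m ∈ L, 0 ≤ pairing x m) →
        x ∈ Submodule.span ℝ≥0 (toReal '' (V : Set (Fin n → ℤ))) := by
  classical
  induction L using Finset.induction_on with
  | empty =>
    refine ⟨Finset.univ.image (fun i => Pi.single i 1) ∪
      Finset.univ.image (fun i => -Pi.single i 1), by simp, fun x _ => ?_⟩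
    have hx : x = ∑ i, Pi.single i (x i) := (Finset.univ_sum_single x).symm
    rw [hx]
    refine Submodule.sum_mem _ fun i _ => ?_
    rcases le_total 0 (x i) with h | h
    · have : (Pi.single i (x i) : Fin n → ℝ) = (⟨x i, h⟩ : ℝ≥0) • toReal (Pi.single i 1) := by
        ext j
        by_cases hj : j = i
        · subst hj; simp [toReal]
        · simp [toReal, hj]
      rw [this]
      refine Submodule.smul_mem _ _ (Submodule.subset_span ⟨_, ?_, rfl⟩)
      simp
    · have : (Pi.single i (x i) : Fin n → ℝ) =
          (⟨-x i, by linarith⟩ : ℝ≥0) • toReal (-Pi.single i 1) := by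
        ext j
        by_cases hj : j = i
        · subst hj; simp [toReal]
        · simp [toReal, hj]
      rw [this]
      refine Submodule.smul_mem _ _ (Submodule.subset_span ⟨_, ?_, rfl⟩)
      simp
  | insert a L ha ih =>
    obtain ⟨V, hV, hgen⟩ := ih
    set d : (Fin n → ℤ) → ℤ := fun v => ∑ i, v i * a i with hd
    have hda : ∀ v, pairing (toReal v) a = d v := fun v => pairing_toReal v a
    have hcomb : ∀ v w,
        toReal (d v • w - d w • v) = (d v : ℝ) • toReal w - (d w : ℝ) • toReal v := by
      intro v w; ext i; simp [toReal]
    have hpair : ∀ v w m, pairing (toReal (d v • w - d w • v)) m =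
        d v * pairing (toReal w) m - d w * pairing (toReal v) m := by
      intro v w m
      rw [hcomb, sub_eq_add_neg, ← neg_smul, pairing_add_left, pairing_smul_left,
        pairing_smul_left]
      ring
    refine ⟨V.filter (fun v => 0 ≤ d v) ∪ ((V ×ˢ V).filter fun p => 0 < d p.1 ∧ d p.2 < 0).image
      fun p => d p.1 • p.2 - d p.2 • p.1, ?_, ?_⟩
    · intro v hv m hm
      rw [Finset.mem_union, Finset.mem_filter, Finset.mem_image] at hv
      rcases hv with ⟨hvV, hdv⟩ | ⟨⟨v', w⟩, hp, rfl⟩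
      · rcases Finset.mem_insert.1 hm with rfl | hm
        · rw [hda]; exact_mod_cast hdv
        · exact hV v hvV m hm
      · simp only [Finset.mem_filter, Finset.mem_product] at hp
        obtain ⟨⟨h1, h2⟩, h3, h4⟩ := hp
        have h3' : (0 : ℝ) < d v' := by exact_mod_cast h3
        have h4' : (d w : ℝ) < 0 := by exact_mod_cast h4
        rw [hpair]
        rcases Finset.mem_insert.1 hm with rfl | hm
        · rw [hda, hda]; linarith
        · have := mul_nonneg h3'.le (hV w h2 m hm)
          have := mul_nonneg (neg_nonneg.2 h4'.le) (hV v' h1 m hm)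
          linarith
    · intro x hx
      have h1 := hgen x fun m hm => hx m (Finset.mem_insert_of_mem hm)
      rw [← Finset.coe_image, Submodule.mem_span_finset] at h1
      obtain ⟨f, -, hf⟩ := h1
      have hinj : Function.Injective (toReal (n := n)) := fun v w h => funext fun i => by
        have := congrFun h i
        simpa [toReal] using this
      rw [Finset.sum_image hinj.injOn] at hf
      have hxa := hx a (Finset.mem_insert_self _ _)
      have hf' : x = ∑ v ∈ V, (f (toReal v) : ℝ) • toReal v := hf.symm
      rw [hf']
      refine mem_span_of_sum_nonneg V toReal (fun v => (d v : ℝ)) (fun v => (f (toReal v) : ℝ))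
        (fun v _ => (f (toReal v)).2) ?_ _ ?_ ?_
      · rw [hf', pairing_sum_left] at hxa
        simpa only [pairing_smul_left, hda] using hxa
      · intro v hv hdv
        refine ⟨v, ?_, rfl⟩
        simp only [Finset.coe_union, Set.mem_union, Finset.mem_coe, Finset.mem_filter]
        exact Or.inl ⟨hv, by exact_mod_cast hdv⟩
      · intro v hv w hw hdv hdw
        refine ⟨_, ?_, hcomb v w⟩
        simp only [Finset.coe_union, Set.mem_union, Finset.mem_coe, Finset.mem_image,
          Finset.mem_filter, Finset.mem_product]
        exact Or.inr ⟨(v, w), ⟨⟨hv, hw⟩, by exact_mod_cast hdv, by exact_mod_cast hdw⟩, rfl⟩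

/-- The generators of a rational polyhedral cone may be taken nonzero. -/
theorem exists_generators {n : ℕ} (L : Finset (Fin n → ℤ)) :
    ∃ V : Finset (Fin n → ℤ), (∀ v ∈ V, v ≠ 0 ∧ ∀ m ∈ L, 0 ≤ pairing (toReal v) m) ∧
      ∀ x : Fin n → ℝ, (∀ m ∈ L, 0 ≤ pairing x m) →
        ∃ t : V → ℝ, (∀ v, 0 ≤ t v) ∧ x = ∑ v, t v • toReal v.1 := by
  classical
  obtain ⟨V, hV, hgen⟩ := exists_generators_aux L
  refine ⟨V.filter (· ≠ 0), fun v hv => ?_, fun x hx => ?_⟩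
  · rw [Finset.mem_filter] at hv
    exact ⟨hv.2, hV v hv.1⟩
  · have h1 := hgen x hx
    rw [← Finset.coe_image, Submodule.mem_span_finset] at h1
    obtain ⟨f, -, hf⟩ := h1
    have hinj : Function.Injective (toReal (n := n)) := fun v w h => funext fun i => by
      have := congrFun h i
      simpa [toReal] using this
    rw [Finset.sum_image hinj.injOn] at hf
    refine ⟨fun v => f (toReal v.1), fun v => (f (toReal v.1)).2, ?_⟩
    rw [Finset.univ_eq_attach, Finset.sum_attach _ fun v => (f (toReal v) : ℝ) • toReal v,
      Finset.sum_filter_of_ne]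
    · exact hf.symm
    · rintro v hv hne rfl
      apply hne
      ext i
      simp [toReal]

/-! ### Asymptotic expansions and Hahn series -/

section Expansion

variable {X : Type*}

/-- `f x t`, as `t → ∞`, has an expansion in exponentials `exp (-w t)`, `w ≥ 0`, up to
`O (exp (-M t))`, that agrees with the Hahn series `h x` in the variable `λ = exp (-t)` up to order
`M`. The coefficients, as functions of the parameter `x`, lie in the algebra `F`, and the exponents
do not depend on `x`. -/
def ExpandsTo (F : Subalgebra ℂ (X → ℂ)) (M : ℝ) (f : X → ℝ → ℂ) (h : X → HahnSeries ℝ ℂ) : Prop :=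
  ∃ (K : Type) (_ : Fintype K) (w : K → ℝ) (c : K → X → ℂ), (∀ k, 0 ≤ w k) ∧ (∀ k, c k ∈ F) ∧
    ∀ x, (M : WithTop ℝ) ≤ (h x - ∑ k, HahnSeries.single (w k) (c k x)).orderTop ∧
      (fun t : ℝ => f x t - ∑ k, c k x * Real.exp (-w k * t)) =O[atTop]
        fun t : ℝ => Real.exp (-M * t)

variable {F : Subalgebra ℂ (X → ℂ)} {M : ℝ} {f g : X → ℝ → ℂ} {h h' : X → HahnSeries ℝ ℂ}

theorem le_orderTop_add {a b : HahnSeries ℝ ℂ} {i : WithTop ℝ} (ha : i ≤ a.orderTop)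
    (hb : i ≤ b.orderTop) : i ≤ (a + b).orderTop :=
  (le_min ha hb).trans HahnSeries.min_orderTop_le_orderTop_add

theorem le_orderTop_sum {K : Type*} {s : Finset K} {a : K → HahnSeries ℝ ℂ} {i : WithTop ℝ}
    (ha : ∀ k ∈ s, i ≤ (a k).orderTop) : i ≤ (∑ k ∈ s, a k).orderTop :=
  Finset.sum_induction a (fun b => i ≤ b.orderTop) (fun _ _ => le_orderTop_add)
    (by simp) ha

theorem le_orderTop_mul {a b : HahnSeries ℝ ℂ} {i j : WithTop ℝ} (ha : i ≤ a.orderTop)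
    (hb : j ≤ b.orderTop) : i + j ≤ (a * b).orderTop :=
  (add_le_add ha hb).trans HahnSeries.orderTop_add_le_mul

theorem le_orderTop_single {w : ℝ} {c : ℂ} : (w : WithTop ℝ) ≤ (HahnSeries.single w c).orderTop :=
  HahnSeries.orderTop_single_le

theorem isBigO_exp_of_le {M w : ℝ} (hw : M ≤ w) :
    (fun t : ℝ => Real.exp (-w * t)) =O[atTop] fun t : ℝ => Real.exp (-M * t) := by
  refine IsBigO.of_bound 1 ?_
  filter_upwards [eventually_ge_atTop 0] with t ht
  rw [one_mul, Real.norm_of_nonneg (Real.exp_pos _).le, Real.norm_of_nonneg (Real.exp_pos _).le]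
  exact Real.exp_le_exp.2 (by nlinarith)

theorem isBigO_ofReal_exp_of_le {M w : ℝ} (hw : M ≤ w) :
    (fun t : ℝ => ((Real.exp (-w * t) : ℝ) : ℂ)) =O[atTop] fun t : ℝ => Real.exp (-M * t) := by
  refine IsBigO.of_norm_left ?_
  simp only [Complex.norm_real]
  exact (isBigO_exp_of_le hw).norm_left

/-- An expansion up to order `M` is insensitive to changes of order `M`. -/
theorem ExpandsTo.congr (hf : ExpandsTo F M f h)
    (h1 : ∀ x, (M : WithTop ℝ) ≤ (h' x - h x).orderTop)
    (h2 : ∀ x, (fun t : ℝ => g x t - f x t) =O[atTop] fun t : ℝ => Real.exp (-M * t)) :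
    ExpandsTo F M g h' := by
  obtain ⟨K, hK, w, c, hw, hc, H⟩ := hf
  refine ⟨K, hK, w, c, hw, hc, fun x => ⟨?_, ?_⟩⟩
  · rw [← sub_add_sub_cancel _ (h x)]
    exact le_orderTop_add (h1 x) (H x).1
  · refine ((h2 x).add (H x).2).congr_left fun t => ?_
    ring

theorem expandsTo_single {w : ℝ} (hw : 0 ≤ w) {c : X → ℂ} (hc : c ∈ F) :
    ExpandsTo F M (fun x t => c x * Real.exp (-w * t)) (fun x => HahnSeries.single w (c x)) := by
  refine ⟨Unit, inferInstance, fun _ => w, fun _ => c, fun _ => hw, fun _ => hc, fun x => ?_⟩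
  simp [isBigO_zero]

theorem expandsTo_const {c : X → ℂ} (hc : c ∈ F) :
    ExpandsTo F M (fun x _ => c x) (fun x => HahnSeries.single 0 (c x)) := by
  simpa using expandsTo_single (M := M) le_rfl hc

theorem ExpandsTo.add (hf : ExpandsTo F M f h) (hg : ExpandsTo F M g h') :
    ExpandsTo F M (fun x t => f x t + g x t) (fun x => h x + h' x) := by
  obtain ⟨K, hK, w, c, hw, hc, H⟩ := hf
  obtain ⟨K', hK', w', c', hw', hc', H'⟩ := hg
  refine ⟨K ⊕ K', inferInstance, Sum.elim w w', Sum.elim c c', ?_, ?_, fun x => ⟨?_, ?_⟩⟩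
  · rintro (k | k)
    exacts [hw k, hw' k]
  · rintro (k | k)
    exacts [hc k, hc' k]
  · simp only [Fintype.sum_sum_type, Sum.elim_inl, Sum.elim_inr]
    rw [add_sub_add_comm]
    exact le_orderTop_add (H x).1 (H' x).1
  · simp only [Fintype.sum_sum_type, Sum.elim_inl, Sum.elim_inr]
    refine ((H x).2.add (H' x).2).congr_left fun t => ?_
    ring

theorem ExpandsTo.mul (hM : 0 ≤ M) (hf : ExpandsTo F M f h) (hg : ExpandsTo F M g h') :
    ExpandsTo F M (fun x t => f x t * g x t) (fun x => h x * h' x) := by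
  obtain ⟨K, hK, w, c, hw, hc, H⟩ := hf
  obtain ⟨K', hK', w', c', hw', hc', H'⟩ := hg
  have hM' : (0 : WithTop ℝ) ≤ (M : WithTop ℝ) := by exact_mod_cast hM
  have hp : ∀ x, (0 : WithTop ℝ) ≤ (∑ k, HahnSeries.single (w k) (c k x)).orderTop := fun x =>
    le_orderTop_sum fun k _ => le_trans (by exact_mod_cast hw k) le_orderTop_single
  have hp' : ∀ x, (0 : WithTop ℝ) ≤ (∑ k, HahnSeries.single (w' k) (c' k x)).orderTop := fun x =>
    le_orderTop_sum fun k _ => le_trans (by exact_mod_cast hw' k) le_orderTop_single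
  have hO : ∀ {L : Type} [Fintype L] (v : L → ℝ) (d : L → ℂ), (∀ k, 0 ≤ v k) →
      (fun t : ℝ => ∑ k, d k * Real.exp (-v k * t)) =O[atTop] fun _ : ℝ => (1 : ℝ) := by
    intro L _ v d hv
    refine IsBigO.fun_sum fun k _ => IsBigO.const_mul_left ?_ _
    have := isBigO_ofReal_exp_of_le (hv k)
    simpa only [neg_zero, zero_mul, Real.exp_zero] using this
  refine ⟨K × K', inferInstance, fun k => w k.1 + w' k.2, fun k => c k.1 * c' k.2,
    fun k => add_nonneg (hw _) (hw' _), fun k => F.mul_mem (hc _) (hc' _), fun x => ⟨?_, ?_⟩⟩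
  · have h1 : ∑ k : K × K', HahnSeries.single (w k.1 + w' k.2) ((c k.1 * c' k.2) x) =
        (∑ k, HahnSeries.single (w k) (c k x)) * ∑ k, HahnSeries.single (w' k) (c' k x) := by
      rw [Finset.sum_mul_sum, ← Finset.univ_product_univ, Finset.sum_product]
      simp [HahnSeries.single_mul_single]
    have h2 : (0 : WithTop ℝ) ≤ (h' x).orderTop := by
      rw [← sub_add_cancel (h' x) (∑ k, HahnSeries.single (w' k) (c' k x))]
      exact le_orderTop_add (hM'.trans (H' x).1) (hp' x)
    rw [h1]
    have h3 : h x * h' x - (∑ k, HahnSeries.single (w k) (c k x)) *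
        ∑ k, HahnSeries.single (w' k) (c' k x) =
        (h x - ∑ k, HahnSeries.single (w k) (c k x)) * h' x +
        (∑ k, HahnSeries.single (w k) (c k x)) *
          (h' x - ∑ k, HahnSeries.single (w' k) (c' k x)) := by ring
    rw [h3]
    refine le_orderTop_add ?_ ?_
    · simpa using le_orderTop_mul (H x).1 h2
    · simpa using le_orderTop_mul (hp x) (H' x).1
  · have h1 : ∀ t : ℝ, ∑ k : K × K', (c k.1 * c' k.2) x * Real.exp (-(w k.1 + w' k.2) * t) =
        (∑ k, c k x * Real.exp (-w k * t)) * ∑ k, c' k x * Real.exp (-w' k * t) := by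
      intro t
      rw [Finset.sum_mul_sum, ← Finset.univ_product_univ, Finset.sum_product]
      refine Finset.sum_congr rfl fun k _ => Finset.sum_congr rfl fun k' _ => ?_
      have : Real.exp (-(w k + w' k') * t) = Real.exp (-w k * t) * Real.exp (-w' k' * t) := by
        rw [← Real.exp_add]; ring_nf
      simp only [this, Pi.mul_apply]
      push_cast
      ring
    have hg1 : (fun t => g x t) =O[atTop] fun _ : ℝ => (1 : ℝ) := by
      have h4 : (fun t : ℝ => Real.exp (-M * t)) =O[atTop] fun _ : ℝ => (1 : ℝ) := by
        simpa using isBigO_exp_of_le hM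
      refine (((H' x).2.trans h4).add (hO w' (fun k => c' k x) hw')).congr_left fun t => ?_
      ring
    have h5 := ((H x).2.mul hg1).add (((H' x).2).mul (hO w (fun k => c k x) hw))
    simp only [mul_one] at h5
    refine h5.congr_left fun t => ?_
    rw [h1]
    ring

theorem expandsTo_sum {L : Type*} (s : Finset L) {f : L → X → ℝ → ℂ}
    {h : L → X → HahnSeries ℝ ℂ} (H : ∀ l ∈ s, ExpandsTo F M (f l) (h l)) :
    ExpandsTo F M (fun x t => ∑ l ∈ s, f l x t) (fun x => ∑ l ∈ s, h l x) := by
  classical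
  induction s using Finset.induction_on with
  | empty => simpa using expandsTo_const (M := M) F.zero_mem
  | insert a s ha ih =>
    simp only [Finset.sum_insert ha]
    exact (H a (Finset.mem_insert_self _ _)).add
      (ih fun l hl => H l (Finset.mem_insert_of_mem hl))

theorem expandsTo_prod (hM : 0 ≤ M) {L : Type*} (s : Finset L) {f : L → X → ℝ → ℂ}
    {h : L → X → HahnSeries ℝ ℂ} (H : ∀ l ∈ s, ExpandsTo F M (f l) (h l)) :
    ExpandsTo F M (fun x t => ∏ l ∈ s, f l x t) (fun x => ∏ l ∈ s, h l x) := by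
  classical
  induction s using Finset.induction_on with
  | empty => simpa [HahnSeries.single_zero_one] using expandsTo_const (M := M) F.one_mem
  | insert a s ha ih =>
    simp only [Finset.prod_insert ha]
    exact (H a (Finset.mem_insert_self _ _)).mul hM
      (ih fun l hl => H l (Finset.mem_insert_of_mem hl))

theorem ringChoose_mem {a : X → ℂ} (ha : a ∈ F) (k : ℕ) : (fun x => Ring.choose (a x) k) ∈ F := by
  have : (fun x => Ring.choose (a x) k) = ((k.factorial : ℂ)⁻¹) •
      ∑ i ∈ (descPochhammer ℤ k).support, (algebraMap ℂ (X → ℂ) ((descPochhammer ℤ k).coeff i : ℂ)) *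
        a ^ i := by
    ext x
    simp [Ring.choose_eq_smul, Polynomial.smeval_eq_sum, Polynomial.sum, Polynomial.smul_pow]
  rw [this]
  exact F.smul_mem (F.sum_mem fun i _ => F.mul_mem (F.algebraMap_mem _) (F.pow_mem ha i)) _

/-- The binomial series, evaluated at a series with positive exponents, is the asymptotic
expansion of the corresponding complex power. -/
theorem expandsTo_heval_binomialSeries (hM : 0 ≤ M) {K : Type*} (s : Finset K) {w : K → ℝ}
    (hw : ∀ k ∈ s, 0 < w k) {c : K → X → ℂ} (hc : ∀ k ∈ s, c k ∈ F) {a : X → ℂ} (ha : a ∈ F) :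
    ExpandsTo F M (fun x t => (1 + ∑ k ∈ s, c k x * Real.exp (-w k * t)) ^ a x)
      (fun x => PowerSeries.heval (∑ k ∈ s, HahnSeries.single (w k) (c k x))
        (PowerSeries.binomialSeries ℂ (a x))) := by
  set J : X → ℝ → ℂ := fun x t => ∑ k ∈ s, c k x * Real.exp (-w k * t) with hJ
  set H : X → HahnSeries ℝ ℂ := fun x => ∑ k ∈ s, HahnSeries.single (w k) (c k x) with hH
  obtain ⟨δ, hδ0, hδ⟩ : ∃ δ : ℝ, 0 < δ ∧ ∀ k ∈ s, δ ≤ w k := by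
    rcases s.eq_empty_or_nonempty with rfl | hs
    · exact ⟨1, one_pos, by simp⟩
    · exact ⟨s.inf' hs w, by simpa using hw, fun k hk => Finset.inf'_le _ hk⟩
  obtain ⟨N, hN⟩ := exists_nat_ge (M / δ)
  rw [div_le_iff₀ hδ0] at hN
  have hJH : ExpandsTo F M J H :=
    expandsTo_sum s fun k hk => expandsTo_single (hw k hk).le (hc k hk)
  have hord : ∀ x, (δ : WithTop ℝ) ≤ (H x).orderTop := fun x =>
    le_orderTop_sum fun k hk => le_trans (by exact_mod_cast hδ k hk) le_orderTop_single
  have hpos : ∀ x, 0 < (H x).orderTop := fun x =>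
    lt_of_lt_of_le (by exact_mod_cast hδ0) (hord x)
  have hpow : ∀ x (k : ℕ), N ≤ k → (M : WithTop ℝ) ≤ ((H x) ^ k).orderTop := by
    intro x k hk
    refine le_trans ?_ HahnSeries.orderTop_nsmul_le_orderTop_pow
    refine le_trans ?_ (nsmul_le_nsmul_right (hord x) k)
    rw [← WithTop.coe_nsmul]
    have : M ≤ k • δ := by
      rw [nsmul_eq_mul]
      exact hN.trans (by gcongr)
    exact_mod_cast this
  -- the powers `J ^ k` with `k ≥ N` have order at least `N δ ≥ M`
  have htrunc : ExpandsTo F M (fun x t => ∑ k ∈ Finset.range N, Ring.choose (a x) k * J x t ^ k)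
      (fun x => ∑ k ∈ Finset.range N, HahnSeries.single 0 (Ring.choose (a x) k) * H x ^ k) := by
    refine expandsTo_sum _ fun k _ => (expandsTo_const (ringChoose_mem ha k)).mul hM ?_
    have := expandsTo_prod hM (Finset.range k) (f := fun _ => J) (h := fun _ => H) fun _ _ => hJH
    simpa using this
  refine htrunc.congr (fun x => ?_) fun x => ?_
  · rw [HahnSeries.le_orderTop_iff_forall]
    intro j hj
    rw [HahnSeries.coeff_sub, PowerSeries.coeff_heval, sub_eq_zero]
    have hterm : ∀ k, ((HahnSeries.SummableFamily.powerSeriesFamily (H x)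
        (PowerSeries.binomialSeries ℂ (a x))).coeff j) k =
        Ring.choose (a x) k * (H x ^ k).coeff j := by
      intro k
      simp [HahnSeries.SummableFamily.coeff_apply, hpos x]
    rw [finsum_eq_sum_of_support_subset (s := Finset.range N)]
    · rw [← HahnSeries.coeff.addMonoidHom_apply, map_sum]
      refine Finset.sum_congr rfl fun k _ => ?_
      rw [hterm]
      simp
    · intro k hk
      rw [Function.mem_support, hterm] at hk
      rw [Finset.mem_coe, Finset.mem_range]
      by_contra hkN
      apply hk
      rw [HahnSeries.coeff_eq_zero_of_lt_orderTop (hj.trans_le (hpow x k (not_lt.1 hkN))), mul_zero]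
  · have hJO : (J x) =O[atTop] fun t : ℝ => Real.exp (-δ * t) := by
      refine IsBigO.fun_sum fun k hk => IsBigO.const_mul_left ?_ _
      exact isBigO_ofReal_exp_of_le (hδ k hk)
    have hJ0 : Tendsto (J x) atTop (𝓝 0) := by
      refine hJO.trans_tendsto ?_
      refine Real.tendsto_exp_atBot.comp ?_
      exact tendsto_id.const_mul_atTop_of_neg (by linarith)
    have h1 := (Complex.one_add_cpow_hasFPowerSeriesAt_zero (a := a x)).isBigO_sub_partialSum_pow N
    have h2 := h1.comp_tendsto hJ0
    have h3 : (fun t => ‖J x t‖ ^ N) =O[atTop] fun t : ℝ => Real.exp (-M * t) := by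
      refine (hJO.norm_left.pow N).trans ?_
      have : (fun t : ℝ => Real.exp (-δ * t) ^ N) = fun t => Real.exp (-(N * δ) * t) := by
        ext t
        rw [← Real.exp_nat_mul]
        ring_nf
      rw [this]
      exact isBigO_exp_of_le hN
    refine (h2.trans h3).congr_left fun t => ?_
    simp only [Function.comp_apply, zero_add, FormalMultilinearSeries.partialSum,
      binomialSeries_apply, List.ofFn_const, List.prod_replicate, smul_eq_mul, hJ]

/-- An expansion up to order `M`, written in terms of the coefficients of the Hahn series. -/
theorem ExpandsTo.exists_finset (hf : ExpandsTo F M f h) :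
    ∃ S : Finset ℝ, (∀ w < M, (fun x => (h x).coeff w) ∈ F) ∧
      (∀ x, ∀ w < M, (h x).coeff w ≠ 0 → w ∈ S) ∧
      ∀ x, (fun t : ℝ => f x t - ∑ w ∈ S with w < M, (h x).coeff w * Real.exp (-w * t)) =O[atTop]
        fun t : ℝ => Real.exp (-M * t) := by
  classical
  obtain ⟨K, hK, w, c, hw, hc, H⟩ := hf
  have hcoeff : ∀ x, ∀ v < M, (h x).coeff v = ∑ k with w k = v, c k x := by
    intro x v hv
    have h1 := HahnSeries.le_orderTop_iff_forall.1 (H x).1 v (by exact_mod_cast hv)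
    rw [HahnSeries.coeff_sub, sub_eq_zero, HahnSeries.coeff_sum] at h1
    rw [h1, Finset.sum_filter]
    refine Finset.sum_congr rfl fun k _ => ?_
    simp [HahnSeries.coeff_single, eq_comm]
  refine ⟨Finset.univ.image w, fun v hv => ?_, fun x v hv hne => ?_, fun x => ?_⟩
  · have : (fun x => (h x).coeff v) = ∑ k with w k = v, c k := by
      ext x
      rw [hcoeff x v hv, Finset.sum_apply]
    rw [this]
    exact F.sum_mem fun k _ => hc k
  · rw [hcoeff x v hv] at hne
    obtain ⟨k, hk, -⟩ := Finset.exists_ne_zero_of_sum_ne_zero hne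
    exact Finset.mem_image.2 ⟨k, Finset.mem_univ _, (Finset.mem_filter.1 hk).2⟩
  · have h1 : ∀ t : ℝ, ∑ v ∈ Finset.univ.image w with v < M, (h x).coeff v * Real.exp (-v * t) =
        ∑ k with w k < M, c k x * Real.exp (-w k * t) := by
      intro t
      rw [← Finset.sum_fiberwise_of_maps_to (s := Finset.univ.filter fun k => w k < M)
        (t := (Finset.univ.image w).filter fun v => v < M) (g := w)]
      · refine Finset.sum_congr rfl fun v hv => ?_
        have hvM := (Finset.mem_filter.1 hv).2
        rw [hcoeff x v hvM, Finset.sum_mul, Finset.filter_filter]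
        have : (Finset.univ.filter fun k => w k < M ∧ w k = v) =
            Finset.univ.filter fun k => w k = v := by
          ext k
          simp only [Finset.mem_filter, Finset.mem_univ, true_and, and_iff_right_iff_imp]
          rintro rfl
          exact hvM
        rw [this]
        refine Finset.sum_congr rfl fun k hk => ?_
        rw [(Finset.mem_filter.1 hk).2]
      · intro k hk
        simp only [Finset.mem_filter, Finset.mem_image, Finset.mem_univ, true_and] at hk ⊢
        exact ⟨⟨k, rfl⟩, hk⟩
    have h2 : (fun t : ℝ => ∑ k with ¬ w k < M, c k x * Real.exp (-w k * t)) =O[atTop]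
        fun t : ℝ => Real.exp (-M * t) := by
      refine IsBigO.fun_sum fun k hk => IsBigO.const_mul_left ?_ _
      exact isBigO_ofReal_exp_of_le (not_lt.1 (Finset.mem_filter.1 hk).2)
    refine ((H x).2.add h2).congr_left fun t => ?_
    rw [h1, ← Finset.sum_filter_add_sum_filter_not Finset.univ (fun k => w k < M)]
    ring

end Expansion

/-! ### Puiseux expansions of Euler integrands -/

theorem monom_expMap {n : ℕ} (m : Fin n → ℤ) (x : Fin n → ℝ) :
    monom m (expMap x) = Real.exp (pairing x m) := by
  simp only [monom, expMap, pairing, Real.exp_sum]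
  refine Finset.prod_congr rfl fun i _ => ?_
  rw [← Real.rpow_intCast, ← Real.exp_mul]

theorem ofReal_exp_cpow (r : ℝ) (c : ℂ) : ((Real.exp r : ℝ) : ℂ) ^ c = Complex.exp (r * c) := by
  rw [Complex.cpow_def_of_ne_zero (by exact_mod_cast (Real.exp_pos r).ne'), ← Complex.ofReal_log
    (Real.exp_pos r).le, Real.log_exp]

namespace PosPoly

variable {n : ℕ} (P : PosPoly n)

theorem coeff_pos {m : Fin n → ℤ} (hm : m ∈ P.coeff.support) : 0 < P.coeff m :=
  lt_of_le_of_ne (P.nonneg m) (Ne.symm (Finsupp.mem_support_iff.1 hm))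

theorem eval_expMap (x : Fin n → ℝ) :
    P.eval (expMap x) = ∑ m ∈ P.coeff.support, P.coeff m * Real.exp (pairing x m) := by
  simp [eval, monom_expMap]

theorem eval_expMap_pos (x : Fin n → ℝ) : 0 < P.eval (expMap x) := by
  rw [eval_expMap]
  exact Finset.sum_pos (fun m hm => mul_pos (P.coeff_pos hm) (Real.exp_pos _)) P.support_nonempty

theorem pairing_le_trop (ρ : Fin n → ℝ) {m : Fin n → ℤ} (hm : m ∈ P.coeff.support) :
    pairing ρ m ≤ P.trop ρ := Finset.le_sup' (pairing ρ) hm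

theorem exists_pairing_eq_trop (ρ : Fin n → ℝ) : ∃ m ∈ P.coeff.support, pairing ρ m = P.trop ρ := by
  obtain ⟨m, hm, h⟩ := Finset.exists_mem_eq_sup' P.support_nonempty (pairing ρ)
  exact ⟨m, hm, h.symm⟩

theorem initialForm_expMap_pos (ρ x : Fin n → ℝ) : 0 < P.initialForm ρ (expMap x) := by
  classical
  obtain ⟨m, hm, h⟩ := P.exists_pairing_eq_trop ρ
  refine Finset.sum_pos (fun m hm => ?_) ⟨m, Finset.mem_filter.2 ⟨hm, h⟩⟩
  rw [monom_expMap]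
  exact mul_pos (P.coeff_pos (Finset.mem_filter.1 hm).1) (Real.exp_pos _)

open Classical in
/-- The exponents of a polynomial on which `ρ · m` is not maximal. -/
noncomputable def lowerSupport (ρ : Fin n → ℝ) : Finset (Fin n → ℤ) :=
  P.coeff.support.filter fun m => pairing ρ m ≠ P.trop ρ

theorem trop_sub_pairing_pos (ρ : Fin n → ℝ) {m : Fin n → ℤ} (hm : m ∈ P.lowerSupport ρ) :
    0 < P.trop ρ - pairing ρ m := by
  classical
  have h := Finset.mem_filter.1 hm
  exact sub_pos.2 (lt_of_le_of_ne (P.pairing_le_trop ρ h.1) h.2)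

/-- The value of the remainder `J` at `λ = exp (-t)`. -/
noncomputable def remainderEval (ρ α : Fin n → ℝ) (t : ℝ) : ℝ :=
  ∑ m ∈ P.lowerSupport ρ, P.coeff m * monom m α / P.initialForm ρ α *
    Real.exp (-(P.trop ρ - pairing ρ m) * t)

theorem remainderEval_nonneg (ρ x : Fin n → ℝ) (t : ℝ) : 0 ≤ P.remainderEval ρ (expMap x) t := by
  refine Finset.sum_nonneg fun m _ => ?_
  rw [monom_expMap]
  have := (P.initialForm_expMap_pos ρ x).le
  have := P.nonneg m
  positivity

/-- The factorisation `P(α λ ^ (-ρ)) = λ ^ (-Trop P(ρ)) P|_ρ(α) (1 + J)` at `λ = exp (-t)`. -/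
theorem eval_expMap_add (ρ x : Fin n → ℝ) (t : ℝ) :
    P.eval (expMap (x + t • ρ)) = Real.exp (t * P.trop ρ) * (P.initialForm ρ (expMap x) *
      (1 + P.remainderEval ρ (expMap x) t)) := by
  classical
  have h0 := (P.initialForm_expMap_pos ρ x).ne'
  have h1 : P.initialForm ρ (expMap x) * P.remainderEval ρ (expMap x) t =
      ∑ m ∈ P.lowerSupport ρ, P.coeff m * monom m (expMap x) *
        Real.exp (-(P.trop ρ - pairing ρ m) * t) := by
    rw [remainderEval, Finset.mul_sum]
    refine Finset.sum_congr rfl fun m _ => ?_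
    field_simp
  rw [mul_add, mul_one, h1, eval_expMap, mul_add, ← Finset.sum_filter_add_sum_filter_not
    P.coeff.support (fun m => pairing ρ m = P.trop ρ), initialForm, Finset.mul_sum, Finset.mul_sum]
  refine congrArg₂ (· + ·) (Finset.sum_congr (by congr) fun m hm => ?_)
    (Finset.sum_congr (by unfold lowerSupport; congr) fun m _ => ?_)
  · have h2 := (Finset.mem_filter.1 hm).2
    rw [monom_expMap, mul_left_comm, ← Real.exp_add, pairing_add_left, pairing_smul_left, h2,
      add_comm]
  · rw [monom_expMap, mul_assoc, ← Real.exp_add, mul_left_comm, ← Real.exp_add, pairing_add_left,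
      pairing_smul_left]
    ring_nf

end PosPoly

/-- The functions of `(x, ε)` that are continuous in `x` and entire in `ε`. -/
def coeffAlgebra (n : ℕ) : Subalgebra ℂ ((Fin n → ℝ) × ℂ → ℂ) where
  carrier := {c | (∀ ε, Continuous fun x => c (x, ε)) ∧ ∀ x, Differentiable ℂ fun ε => c (x, ε)}
  mul_mem' ha hb := ⟨fun ε => (ha.1 ε).mul (hb.1 ε), fun x => (ha.2 x).mul (hb.2 x)⟩
  add_mem' ha hb := ⟨fun ε => (ha.1 ε).add (hb.1 ε), fun x => (ha.2 x).add (hb.2 x)⟩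
  algebraMap_mem' _ := ⟨fun _ => continuous_const, fun _ => differentiable_const _⟩

theorem affine_mem_coeffAlgebra {n : ℕ} (e : ℂ × ℂ) :
    (fun p : (Fin n → ℝ) × ℂ => affine e p.2) ∈ coeffAlgebra n :=
  ⟨fun ε => (continuous_const : Continuous fun _ : Fin n → ℝ => affine e ε),
    fun _ => by unfold affine; fun_prop⟩

theorem ofReal_mem_coeffAlgebra {n : ℕ} {g : (Fin n → ℝ) → ℝ} (hg : Continuous g) :
    (fun p : (Fin n → ℝ) × ℂ => (g p.1 : ℂ)) ∈ coeffAlgebra n :=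
  ⟨fun _ => by fun_prop, fun x => (differentiable_const (g x : ℂ) : Differentiable ℂ fun _ : ℂ => _)⟩

theorem cpow_mem_coeffAlgebra {n : ℕ} {g : (Fin n → ℝ) → ℝ} (hg : Continuous g)
    (h0 : ∀ x, 0 < g x) (e : ℂ × ℂ) :
    (fun p : (Fin n → ℝ) × ℂ => (g p.1 : ℂ) ^ affine e p.2) ∈ coeffAlgebra n := by
  refine ⟨fun ε => ?_, fun x => ?_⟩
  · exact Continuous.cpow (f := fun x => (g x : ℂ)) (g := fun _ => affine e ε) (by fun_prop)
      (by fun_prop) fun x => Complex.ofReal_mem_slitPlane.2 (h0 x)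
  · have : Differentiable ℂ fun ε => affine e ε := by unfold affine; fun_prop
    exact this.const_cpow (c := (g x : ℂ)) (Or.inl (by exact_mod_cast (h0 x).ne'))

theorem continuous_monom_expMap {n : ℕ} (m : Fin n → ℤ) :
    Continuous fun x => monom m (expMap x) := by
  simp only [monom_expMap, pairing]
  fun_prop

theorem PosPoly.continuous_initialForm_expMap {n : ℕ} (P : PosPoly n) (ρ : Fin n → ℝ) :
    Continuous fun x => P.initialForm ρ (expMap x) := by
  unfold PosPoly.initialForm
  exact continuous_finsetSum _ fun m _ => continuous_const.mul (continuous_monom_expMap m)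

theorem PosPoly.continuous_eval_expMap {n : ℕ} (P : PosPoly n) :
    Continuous fun x => P.eval (expMap x) := by
  unfold PosPoly.eval
  exact continuous_finsetSum _ fun m _ => continuous_const.mul (continuous_monom_expMap m)

namespace Integrand

variable {n : ℕ} (I : Integrand n)

theorem eval_mem_coeffAlgebra :
    (fun p : (Fin n → ℝ) × ℂ => I.eval (expMap p.1) p.2) ∈ coeffAlgebra n := by
  have h1 : (fun p : (Fin n → ℝ) × ℂ => I.eval (expMap p.1) p.2) =
      (∏ i, fun p : (Fin n → ℝ) × ℂ => ((Real.exp (p.1 i) : ℝ) : ℂ) ^ affine (I.ν i) p.2) *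
        ∏ j, fun p : (Fin n → ℝ) × ℂ => ((I.P j).eval (expMap p.1) : ℂ) ^ affine (I.c j) p.2 := by
    ext p
    simp only [Pi.mul_apply, Finset.prod_apply]
    rfl
  rw [h1]
  refine mul_mem (prod_mem fun i _ => ?_) (prod_mem fun j _ => ?_)
  · exact cpow_mem_coeffAlgebra (g := fun x => Real.exp (x i)) (by fun_prop)
      (fun x => Real.exp_pos _) _
  · exact cpow_mem_coeffAlgebra (I.P j).continuous_eval_expMap (I.P j).eval_expMap_pos _

theorem initialForm_mem_coeffAlgebra (ρ : Fin n → ℝ) :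
    (fun p : (Fin n → ℝ) × ℂ => I.initialForm ρ (expMap p.1) p.2) ∈ coeffAlgebra n := by
  have h1 : (fun p : (Fin n → ℝ) × ℂ => I.initialForm ρ (expMap p.1) p.2) =
      (∏ i, fun p : (Fin n → ℝ) × ℂ => ((Real.exp (p.1 i) : ℝ) : ℂ) ^ affine (I.ν i) p.2) *
        ∏ j, fun p : (Fin n → ℝ) × ℂ =>
          ((I.P j).initialForm ρ (expMap p.1) : ℂ) ^ affine (I.c j) p.2 := by
    ext p
    simp only [Pi.mul_apply, Finset.prod_apply]
    rfl
  rw [h1]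
  refine mul_mem (prod_mem fun i _ => ?_) (prod_mem fun j _ => ?_)
  · exact cpow_mem_coeffAlgebra (g := fun x => Real.exp (x i)) (by fun_prop)
      (fun x => Real.exp_pos _) _
  · exact cpow_mem_coeffAlgebra ((I.P j).continuous_initialForm_expMap ρ)
      ((I.P j).initialForm_expMap_pos ρ) _

theorem affine_trop (ρ : Fin n → ℝ) (ε : ℂ) :
    affine (I.trop ρ) ε = ∑ i, (ρ i : ℂ) * affine (I.ν i) ε +
      ∑ j, ((I.P j).trop ρ : ℂ) * affine (I.c j) ε := by
  simp only [affine, trop, Prod.fst_add, Prod.snd_add, Prod.fst_sum, Prod.snd_sum, Prod.smul_fst,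
    Prod.smul_snd, smul_eq_mul, mul_add, Finset.sum_add_distrib, add_mul, Finset.sum_mul, mul_assoc]
  ring

/-- The factorisation `I(α λ ^ (-ρ)) = λ ^ (-Trop I(ρ)) I|_ρ(α) ∏ j, (1 + J_j) ^ c_j` at
`λ = exp (-t)`. -/
theorem eval_expMap_add (ρ x : Fin n → ℝ) (ε : ℂ) (t : ℝ) :
    I.eval (expMap (x + t • ρ)) ε = Complex.exp (t * affine (I.trop ρ) ε) *
      (I.initialForm ρ (expMap x) ε *
        ∏ j, (1 + ((I.P j).remainderEval ρ (expMap x) t : ℂ)) ^ affine (I.c j) ε) := by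
  have h1 : ∀ i, ((expMap (x + t • ρ) i : ℝ) : ℂ) ^ affine (I.ν i) ε =
      Complex.exp (t * (ρ i * affine (I.ν i) ε)) * ((expMap x i : ℝ) : ℂ) ^ affine (I.ν i) ε := by
    intro i
    simp only [expMap, Pi.add_apply, Pi.smul_apply, smul_eq_mul, ofReal_exp_cpow]
    rw [← Complex.exp_add]
    push_cast
    ring_nf
  have h2 : ∀ j, (((I.P j).eval (expMap (x + t • ρ)) : ℝ) : ℂ) ^ affine (I.c j) ε =
      Complex.exp (t * ((I.P j).trop ρ * affine (I.c j) ε)) *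
        ((((I.P j).initialForm ρ (expMap x) : ℝ) : ℂ) ^ affine (I.c j) ε *
        (1 + ((I.P j).remainderEval ρ (expMap x) t : ℂ)) ^ affine (I.c j) ε) := by
    intro j
    have h3 := (I.P j).initialForm_expMap_pos ρ x
    have h4 := (I.P j).remainderEval_nonneg ρ x t
    rw [PosPoly.eval_expMap_add, Complex.ofReal_mul, Complex.mul_cpow_ofReal_nonneg
      (Real.exp_pos _).le (by positivity), Complex.ofReal_mul, Complex.mul_cpow_ofReal_nonneg
      h3.le (by positivity), ofReal_exp_cpow]
    push_cast
    ring_nf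
  rw [affine_trop, eval, initialForm, Finset.prod_congr rfl fun i _ => h1 i,
    Finset.prod_congr rfl fun j _ => h2 j]
  simp only [Finset.prod_mul_distrib, ← Complex.exp_sum, mul_add, Complex.exp_add, Finset.mul_sum]
  ring

/-- The formal series that defines `τ_ρ I` is an asymptotic expansion. -/
theorem expandsTo_series (ρ : Fin n → ℝ) {M : ℝ} (hM : 0 ≤ M) :
    ExpandsTo (coeffAlgebra n) M
      (fun p t => I.initialForm ρ (expMap p.1) p.2 *
        ∏ j, (1 + ((I.P j).remainderEval ρ (expMap p.1) t : ℂ)) ^ affine (I.c j) p.2)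
      (fun p => I.series ρ (expMap p.1) p.2) := by
  classical
  have h1 := (expandsTo_const (M := M) (I.initialForm_mem_coeffAlgebra ρ)).mul hM
    (expandsTo_prod hM Finset.univ fun j _ =>
      expandsTo_heval_binomialSeries hM ((I.P j).lowerSupport ρ)
      (w := fun m => (I.P j).trop ρ - pairing ρ m)
      (fun m hm => (I.P j).trop_sub_pairing_pos ρ hm)
      (c := fun m (p : (Fin n → ℝ) × ℂ) => (((I.P j).coeff m * monom m (expMap p.1) /
        (I.P j).initialForm ρ (expMap p.1) : ℝ) : ℂ))
      (fun m _ => ofReal_mem_coeffAlgebra (((continuous_monom_expMap m).const_mul _).div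
        ((I.P j).continuous_initialForm_expMap ρ)
        fun x => ((I.P j).initialForm_expMap_pos ρ x).ne'))
      (affine_mem_coeffAlgebra (I.c j)))
  refine h1.congr (fun p => ?_) (fun p => ?_)
  · rw [HahnSeries.single_zero_mul_eq_smul]
    have : I.series ρ (expMap p.1) p.2 = I.initialForm ρ (expMap p.1) p.2 • ∏ j,
      PowerSeries.heval (∑ m ∈ (I.P j).lowerSupport ρ,
        HahnSeries.single ((I.P j).trop ρ - pairing ρ m)
        ((((I.P j).coeff m * monom m (expMap p.1) /
        (I.P j).initialForm ρ (expMap p.1) : ℝ) : ℂ)))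
      (PowerSeries.binomialSeries ℂ (affine (I.c j) p.2)) := by
      unfold series PosPoly.remainder PosPoly.lowerSupport
      rfl
    rw [this, sub_self]
    simp
  · have : ∀ t : ℝ, ∀ j, ((I.P j).remainderEval ρ (expMap p.1) t : ℂ) =
      ∑ m ∈ (I.P j).lowerSupport ρ, (((I.P j).coeff m * monom m (expMap p.1) /
        (I.P j).initialForm ρ (expMap p.1) : ℝ) : ℂ) *
        Real.exp (-((I.P j).trop ρ - pairing ρ m) * t) := by
      intro t j
      rw [PosPoly.remainderEval]
      push_cast
      rfl
    simp only [this, sub_self]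
    exact isBigO_zero _ _

theorem tauCoeff_sub_trop (ρ : Fin n → ℝ) (w : ℝ) (α : Fin n → ℝ) (ε : ℂ) :
    I.tauCoeff ρ ((((w : ℝ) : ℂ), 0) - I.trop ρ) α ε = (I.series ρ α ε).coeff w := by
  simp [tauCoeff]

theorem exists_of_tauCoeff_ne_zero {ρ : Fin n → ℝ} {e : ℂ × ℂ} {α : Fin n → ℝ} {ε : ℂ}
    (h : I.tauCoeff ρ e α ε ≠ 0) :
    ∃ w : ℝ, e = (((w : ℝ) : ℂ), 0) - I.trop ρ := by
  rw [tauCoeff] at h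
  split_ifs at h with h1
  · exact ⟨_, eq_sub_of_add_eq h1⟩
  · exact absurd rfl h

theorem tauCoeff_mem_coeffAlgebra (ρ : Fin n → ℝ) (e : ℂ × ℂ) :
    (fun p : (Fin n → ℝ) × ℂ => I.tauCoeff ρ e (expMap p.1) p.2) ∈ coeffAlgebra n := by
  by_cases he : e + I.trop ρ = ((((e + I.trop ρ).1.re : ℝ) : ℂ), 0)
  · simp only [tauCoeff, if_pos he]
    obtain ⟨S, hS, -⟩ := (I.expandsTo_series ρ (M := |(e + I.trop ρ).1.re| + 1)
      (by positivity)).exists_finset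
    exact hS _ (lt_of_le_of_lt (le_abs_self _) (lt_add_one _))
  · simp only [tauCoeff, if_neg he]
    exact (coeffAlgebra n).zero_mem

/-- The Puiseux expansion of an Euler integrand along `ρ`, up to the exponents with real part at
least `M` at `ε = 0`. -/
theorem exists_isBigO_tau (ρ : Fin n → ℝ) {M : ℝ} (hM : 0 ≤ M + (I.trop ρ).1.re) :
    ∃ E : Finset (ℂ × ℂ), (∀ e : ℂ × ℂ, e.1.re < M →
        ∀ x ε, I.tauCoeff ρ e (expMap x) ε ≠ 0 → e ∈ E) ∧
      ∀ E' : Finset (ℂ × ℂ), E ⊆ E' → ∀ x ε,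
        (fun t : ℝ => I.eval (expMap (x + t • ρ)) ε - ∑ e ∈ E' with e.1.re < M,
          I.tauCoeff ρ e (expMap x) ε * Complex.exp (-affine e ε * t)) =O[atTop]
        fun t : ℝ => Real.exp (-(M - ((I.trop ρ).2 * ε).re) * t) := by
  classical
  set T := I.trop ρ with hT
  obtain ⟨S, -, hS, hO⟩ := (I.expandsTo_series ρ hM).exists_finset
  -- the exponent of `λ` in `τ_ρ I` that comes from `λ ^ w` in the series
  set φ : ℝ → ℂ × ℂ := fun w => (((w : ℝ) : ℂ), 0) - T with hφ
  have hφinj : Function.Injective φ := by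
    intro w w' h
    have := congrArg Prod.fst h
    simpa [hφ] using this
  have hφre : ∀ w, (φ w).1.re = w - T.1.re := fun w => by simp [hφ]
  have hτ : ∀ w x ε, I.tauCoeff ρ (φ w) (expMap x) ε = (I.series ρ (expMap x) ε).coeff w :=
    fun w x ε => I.tauCoeff_sub_trop ρ w _ ε
  have hmem : ∀ e : ℂ × ℂ, e.1.re < M → ∀ x ε, I.tauCoeff ρ e (expMap x) ε ≠ 0 →
      ∃ w ∈ S, w < M + T.1.re ∧ φ w = e := by
    intro e he x ε hne
    obtain ⟨w, rfl⟩ := I.exists_of_tauCoeff_ne_zero hne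
    have hw : w < M + T.1.re := by
      have := hφre w
      simp only [hφ] at this
      rw [← hT, this] at he
      linarith
    refine ⟨w, hS (x, ε) w hw ?_, hw, rfl⟩
    rwa [tauCoeff_sub_trop] at hne
  refine ⟨S.image φ, fun e he x ε hne => ?_, fun E' hE' x ε => ?_⟩
  · obtain ⟨w, hwS, -, rfl⟩ := hmem e he x ε hne
    exact Finset.mem_image_of_mem _ hwS
  · have hsum : ∀ t : ℝ, ∑ e ∈ E' with e.1.re < M,
        I.tauCoeff ρ e (expMap x) ε * Complex.exp (-affine e ε * t) =
        Complex.exp (t * affine T ε) * ∑ w ∈ S with w < M + T.1.re,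
          (I.series ρ (expMap x) ε).coeff w * Real.exp (-w * t) := by
      intro t
      rw [← Finset.sum_subset (s₁ := (S.filter fun w => w < M + T.1.re).image φ),
        Finset.sum_image hφinj.injOn, Finset.mul_sum]
      · refine Finset.sum_congr rfl fun w _ => ?_
        rw [hτ, Complex.ofReal_exp, mul_left_comm, ← Complex.exp_add]
        simp only [hφ, affine, Prod.fst_sub, Prod.snd_sub]
        push_cast
        ring_nf
      · intro e he
        obtain ⟨w, hw, rfl⟩ := Finset.mem_image.1 he
        rw [Finset.mem_filter] at hw
        rw [Finset.mem_filter]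
        refine ⟨hE' (Finset.mem_image_of_mem _ hw.1), ?_⟩
        rw [hφre]
        linarith
      · intro e he hne
        by_contra h
        obtain ⟨w, hwS, hw, rfl⟩ := hmem e (Finset.mem_filter.1 he).2 x ε fun h0 => h (by simp [h0])
        exact hne (Finset.mem_image_of_mem _ (Finset.mem_filter.2 ⟨hwS, hw⟩))
    have h1 : (fun t : ℝ => Complex.exp (t * affine T ε)) =O[atTop]
        fun t : ℝ => Real.exp ((affine T ε).re * t) := by
      refine IsBigO.of_bound 1 (Eventually.of_forall fun t => ?_)
      rw [Complex.norm_exp, one_mul, Real.norm_of_nonneg (Real.exp_pos _).le, mul_comm]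
      simp
    refine (h1.mul (hO (x, ε))).congr (fun t => ?_) (fun t => ?_)
    · rw [hsum, eval_expMap_add]
      ring
    · rw [← Real.exp_add]
      simp only [affine, Complex.add_re]
      ring_nf

end Integrand

namespace Combination

variable {n : ℕ} (I : Combination n)

theorem tauCoeff_mem_coeffAlgebra (ρ : Fin n → ℝ) (e : ℂ × ℂ) :
    (fun p : (Fin n → ℝ) × ℂ => I.tauCoeff ρ e (expMap p.1) p.2) ∈ coeffAlgebra n := by
  have : (fun p : (Fin n → ℝ) × ℂ => I.tauCoeff ρ e (expMap p.1) p.2) =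
      ∑ i, I.κ i • fun p : (Fin n → ℝ) × ℂ => (I.term i).tauCoeff ρ e (expMap p.1) p.2 := by
    ext p
    simp [tauCoeff]
  rw [this]
  exact sum_mem fun i _ => (coeffAlgebra n).smul_mem ((I.term i).tauCoeff_mem_coeffAlgebra ρ e) _

theorem eval_mem_coeffAlgebra :
    (fun p : (Fin n → ℝ) × ℂ => I.eval (expMap p.1) p.2) ∈ coeffAlgebra n := by
  have : (fun p : (Fin n → ℝ) × ℂ => I.eval (expMap p.1) p.2) =
      ∑ i, I.κ i • fun p : (Fin n → ℝ) × ℂ => (I.term i).eval (expMap p.1) p.2 := by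
    ext p
    simp [eval]
  rw [this]
  exact sum_mem fun i _ => (coeffAlgebra n).smul_mem (I.term i).eval_mem_coeffAlgebra _

theorem mem_exponents_iff {ρ : Fin n → ℝ} {e : ℂ × ℂ} :
    e ∈ I.exponents ρ ↔ ∃ x ε, I.tauCoeff ρ e (expMap x) ε ≠ 0 := by
  constructor
  · rintro ⟨α, hα, ε, h⟩
    exact ⟨fun i => Real.log (α i), ε, by rwa [expMap_log hα]⟩
  · rintro ⟨x, ε, h⟩
    exact ⟨_, fun i => Real.exp_pos _, ε, h⟩

/-- The slopes in `ε` of the exponents of `τ_ρ I`. -/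
theorem exists_snd_eq {ρ : Fin n → ℝ} {e : ℂ × ℂ} (he : e ∈ I.exponents ρ) :
    ∃ i, e.2 = -((I.term i).trop ρ).2 := by
  obtain ⟨α, -, ε, h⟩ := he
  obtain ⟨i, -, hi⟩ := Finset.exists_ne_zero_of_sum_ne_zero h
  obtain ⟨w, hw⟩ := (I.term i).exists_of_tauCoeff_ne_zero (right_ne_zero_of_mul hi)
  exact ⟨i, by simp [hw]⟩

/-- The Puiseux expansion of a combination of Euler integrands along `ρ`. Only finitely many
exponents have real part below `M` at `ε = 0`. -/
theorem exists_isBigO_tau (ρ : Fin n → ℝ) {M : ℝ}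
    (hM : ∀ i, 0 ≤ M + ((I.term i).trop ρ).1.re) :
    ∃ E : Finset (ℂ × ℂ), (∀ e, e ∈ E ↔ e ∈ I.exponents ρ ∧ e.1.re < M) ∧
      ∀ (x : Fin n → ℝ) (ε : ℂ) (μ : ℝ), (∀ i, μ ≤ M - (((I.term i).trop ρ).2 * ε).re) →
        (fun t : ℝ => I.eval (expMap (x + t • ρ)) ε - ∑ e ∈ E,
          I.tauCoeff ρ e (expMap x) ε * Complex.exp (-affine e ε * t)) =O[atTop]
        fun t : ℝ => Real.exp (-μ * t) := by
  classical
  choose E hE hO using fun i => (I.term i).exists_isBigO_tau ρ (hM i)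
  set E' := Finset.univ.biUnion E with hE'
  have hsub : ∀ i, E i ⊆ E' := fun i => Finset.subset_biUnion_of_mem E (Finset.mem_univ i)
  have hmem : ∀ e ∈ I.exponents ρ, e.1.re < M → e ∈ E' := by
    intro e he heM
    obtain ⟨x, ε, h⟩ := I.mem_exponents_iff.1 he
    obtain ⟨i, -, hi⟩ := Finset.exists_ne_zero_of_sum_ne_zero h
    exact hsub i (hE i e heM x ε (right_ne_zero_of_mul hi))
  refine ⟨E'.filter fun e => e.1.re < M ∧ e ∈ I.exponents ρ, fun e => ?_, fun x ε μ hμ => ?_⟩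
  · rw [Finset.mem_filter]
    exact ⟨fun h => ⟨h.2.2, h.2.1⟩, fun h => ⟨hmem e h.1 h.2, h.2, h.1⟩⟩
  · have h1 : (fun t : ℝ => ∑ i, I.κ i * ((I.term i).eval (expMap (x + t • ρ)) ε -
        ∑ e ∈ E' with e.1.re < M,
          (I.term i).tauCoeff ρ e (expMap x) ε * Complex.exp (-affine e ε * t))) =O[atTop]
        fun t : ℝ => Real.exp (-μ * t) := by
      refine IsBigO.fun_sum fun i _ => IsBigO.const_mul_left ?_ _
      exact (hO i E' (hsub i) x ε).trans (isBigO_exp_of_le (hμ i))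
    refine h1.congr_left fun t => ?_
    simp only [mul_sub, Finset.sum_sub_distrib]
    refine congrArg₂ (· - ·) rfl ?_
    rw [← Finset.filter_filter, Finset.sum_filter_of_ne]
    · simp only [Finset.mul_sum]
      rw [Finset.sum_comm]
      refine Finset.sum_congr rfl fun e _ => ?_
      rw [tauCoeff, Finset.sum_mul]
      exact Finset.sum_congr rfl fun i _ => by ring
    · intro e _ hne
      exact I.mem_exponents_iff.2 ⟨x, ε, left_ne_zero_of_mul hne⟩

/-! ### The leading exponents -/

/-- A bound `M` to which the expansion along `ρ` can be taken. Since `M` is at least `1`, all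
exponents with non-positive real part at `ε = 0` lie below it. -/
theorem exists_cutoff (ρ : Fin n → ℝ) :
    ∃ M : ℝ, 1 ≤ M ∧ ∀ i, 0 ≤ M + ((I.term i).trop ρ).1.re := by
  refine ⟨1 + ∑ i, |((I.term i).trop ρ).1.re|, ?_, fun i => ?_⟩
  · have : 0 ≤ ∑ i, |((I.term i).trop ρ).1.re| := Finset.sum_nonneg fun i _ => abs_nonneg _
    linarith
  · have h1 := Finset.single_le_sum (f := fun i => |((I.term i).trop ρ).1.re|)
      (fun i _ => abs_nonneg _) (Finset.mem_univ i)
    have h2 := neg_abs_le ((I.term i).trop ρ).1.re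
    linarith

/-- The exponents have no accumulation point, so positivity of their real parts at `ε = 0` is
uniform. -/
theorem exists_pos_le_re {ρ : Fin n → ℝ} (h : ∀ e ∈ I.exponents ρ, 0 < e.1.re) :
    ∃ δ : ℝ, 0 < δ ∧ ∀ e ∈ I.exponents ρ, δ ≤ e.1.re := by
  obtain ⟨M, hM1, hM⟩ := I.exists_cutoff ρ
  obtain ⟨E, hE, -⟩ := I.exists_isBigO_tau ρ hM
  rcases E.eq_empty_or_nonempty with rfl | hne
  · refine ⟨M, by linarith, fun e he => ?_⟩
    by_contra hlt
    exact absurd ((hE e).2 ⟨he, not_le.1 hlt⟩) (Finset.notMem_empty _)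
  · refine ⟨min M (E.inf' hne fun e => e.1.re), lt_min (by linarith) ?_, fun e he => ?_⟩
    · rw [Finset.lt_inf'_iff]
      exact fun e he => h e ((hE e).1 he).1
    · by_cases hlt : e.1.re < M
      · exact (min_le_right _ _).trans (Finset.inf'_le _ ((hE e).2 ⟨he, hlt⟩))
      · exact (min_le_left _ _).trans (not_lt.1 hlt)

theorem abs_re_snd_mul_le {ρ : Fin n → ℝ} {e : ℂ × ℂ} (he : e ∈ I.exponents ρ) (ε : ℂ) :
    |(e.2 * ε).re| ≤ (∑ i, ‖((I.term i).trop ρ).2‖) * ‖ε‖ := by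
  obtain ⟨i, hi⟩ := I.exists_snd_eq he
  refine (Complex.abs_re_le_norm _).trans ?_
  rw [norm_mul, hi, norm_neg]
  gcongr
  exact Finset.single_le_sum (f := fun i => ‖((I.term i).trop ρ).2‖)
    (fun i _ => norm_nonneg _) (Finset.mem_univ i)

/-- The tropical condition at `ρ`. The slopes of the exponents are bounded, so `Trop I(ρ)` is its
value at `ε = 0` up to `O(ε)`, and that value is attained unless there are no exponents. -/
theorem exists_tropEq_iff (ρ : Fin n → ℝ) :
    (∃ a : EReal, a < 0 ∧ I.TropEq ρ a) ↔ ∀ e ∈ I.exponents ρ, 0 < e.1.re := by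
  constructor
  · rintro ⟨a, ha, C, hC⟩ e he
    have h1 := hC.self_of_nhds.1
    simp only [norm_zero, mul_zero, EReal.coe_zero, add_zero] at h1
    have h2 : ((-(affine e 0).re : ℝ) : EReal) ≤ I.trop ρ 0 :=
      le_iSup₂ (f := fun e (_ : e ∈ I.exponents ρ) => ((-(affine e 0).re : ℝ) : EReal)) e he
    have h3 := (h2.trans h1).trans_lt ha
    have h4 : -(affine e 0).re < 0 := by exact_mod_cast h3
    simpa [affine] using h4
  · intro h
    obtain ⟨δ, hδ, hδe⟩ := I.exists_pos_le_re h
    refine ⟨⨆ e ∈ I.exponents ρ, ((-e.1.re : ℝ) : EReal), ?_,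
      ∑ i, ‖((I.term i).trop ρ).2‖, Eventually.of_forall fun ε => ⟨?_, ?_⟩⟩
    · refine lt_of_le_of_lt (b := ((-δ : ℝ) : EReal)) (iSup₂_le fun e he => ?_) ?_
      · have := hδe e he
        exact_mod_cast neg_le_neg this
      · exact_mod_cast neg_lt_zero.2 hδ
    · refine iSup₂_le fun e he => ?_
      have h1 := abs_le.1 (I.abs_re_snd_mul_le he ε)
      have h2 : -(affine e ε).re ≤ -e.1.re + (∑ i, ‖((I.term i).trop ρ).2‖) * ‖ε‖ := by
        simp only [affine, Complex.add_re]
        linarith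
      refine (EReal.coe_le_coe_iff.2 h2).trans ?_
      rw [EReal.coe_add]
      gcongr
      exact le_iSup₂ (f := fun e (_ : e ∈ I.exponents ρ) => ((-e.1.re : ℝ) : EReal)) e he
    · refine iSup₂_le fun e he => ?_
      have h1 := abs_le.1 (I.abs_re_snd_mul_le he ε)
      have h2 : -e.1.re ≤ -(affine e ε).re + (∑ i, ‖((I.term i).trop ρ).2‖) * ‖ε‖ := by
        simp only [affine, Complex.add_re]
        linarith
      refine (EReal.coe_le_coe_iff.2 h2).trans ?_
      rw [EReal.coe_add]
      gcongr
      exact le_iSup₂ (f := fun e (_ : e ∈ I.exponents ρ) => ((-(affine e ε).re : ℝ) : EReal)) e he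

/-! ### Necessity -/

theorem continuous_eval_expMap (ε : ℂ) : Continuous fun x => I.eval (expMap x) ε :=
  I.eval_mem_coeffAlgebra.1 ε

/-- If the integral converges absolutely at `ε`, then no term of the Puiseux series whose exponent
at `ε` has non-positive real part survives, provided that exponent differs at `ε` from the others
in a finite range. -/
theorem tauCoeff_eq_zero_of_integrable {ρ : Fin n → ℝ} (hρ : ρ ≠ 0) {ε : ℂ}
    (hint : Integrable (fun α => I.eval α ε) (canonicalMeasure n)) {E : Finset (ℂ × ℂ)}
    {e₀ : ℂ × ℂ} (he₀ : e₀ ∈ E) (hre : (affine e₀ ε).re ≤ 0)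
    (hsep : ∀ e ∈ E, e ≠ e₀ → affine e ε ≠ affine e₀ ε)
    {μ : ℝ} (hμ : 0 < μ) (hO : ∀ x : Fin n → ℝ,
      (fun t : ℝ => I.eval (expMap (x + t • ρ)) ε - ∑ e ∈ E,
          I.tauCoeff ρ e (expMap x) ε * Complex.exp (-affine e ε * t)) =O[atTop]
        fun t : ℝ => Real.exp (-μ * t)) (x : Fin n → ℝ) :
    I.tauCoeff ρ e₀ (expMap x) ε = 0 := by
  classical
  have hcont := I.continuous_eval_expMap ε
  rw [canonicalMeasure_eq_map, measurableEmbedding_expMap.integrable_map_iff] at hint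
  have hae : ∀ᵐ x : Fin n → ℝ, I.tauCoeff ρ e₀ (expMap x) ε = 0 := by
    filter_upwards [ae_integrableOn_ray hcont hint hρ] with x hx
    have h1 : IntegrableOn (fun t : ℝ => I.eval (expMap (x + t • ρ)) ε - ∑ e ∈ E,
        I.tauCoeff ρ e (expMap x) ε * Complex.exp (-affine e ε * t)) (Set.Ioi 0) := by
      have hc : Continuous fun t : ℝ => I.eval (expMap (x + t • ρ)) ε - ∑ e ∈ E,
          I.tauCoeff ρ e (expMap x) ε * Complex.exp (-affine e ε * t) :=
        (hcont.comp (by fun_prop : Continuous fun t : ℝ => x + t • ρ)).sub (by fun_prop)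
      exact ((hc.locallyIntegrable.locallyIntegrableOn _).integrableOn_of_isBigO_atTop (hO x)
        ⟨Set.Ioi 0, Ioi_mem_atTop 0, exp_neg_integrableOn_Ioi 0 hμ⟩).mono_set Set.Ioi_subset_Ici_self
    refine coeff_eq_zero_of_integrableOn_sum_exp (E.erase e₀) (z := fun e => -affine e ε)
      (z₀ := -affine e₀ ε) (by simpa using hre) ?_
      (fun e => I.tauCoeff ρ e (expMap x) ε) _ ((hx.sub h1).congr (Eventually.of_forall fun t => ?_))
    · intro e he h
      exact hsep e (Finset.mem_of_mem_erase he) (Finset.ne_of_mem_erase he) (neg_injective h)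
    · simp only [Pi.sub_apply, sub_sub_cancel]
      rw [← Finset.add_sum_erase E _ he₀]
  have hc : Continuous fun x => I.tauCoeff ρ e₀ (expMap x) ε :=
    (I.tauCoeff_mem_coeffAlgebra ρ e₀).1 ε
  exact congrFun (Continuous.ae_eq_iff_eq volume hc continuous_const |>.1 hae) x

/-- Arbitrarily close to `0` there are parameters at which a given exponent, of non-positive real
part at `0`, still has non-positive real part. -/
theorem frequently_re_affine_nonpos {e : ℂ × ℂ} (he : e.1.re ≤ 0) :
    ∃ᶠ ε in 𝓝[≠] (0 : ℂ), (affine e ε).re ≤ 0 := by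
  -- a direction `v` in which `Re e` does not increase; `-conj e.2` works unless `e` is constant
  obtain ⟨v, hv, hve⟩ : ∃ v : ℂ, v ≠ 0 ∧ (e.2 * v).re ≤ 0 := by
    by_cases h : e.2 = 0
    · exact ⟨1, one_ne_zero, by simp [h]⟩
    · refine ⟨-(starRingEnd ℂ) e.2, by simpa using h, ?_⟩
      rw [mul_neg, Complex.mul_conj, Complex.neg_re, Complex.ofReal_re]
      exact neg_nonpos.2 (Complex.normSq_nonneg _)
  have hlim : Tendsto (fun τ : ℝ => (τ : ℂ) * v) (𝓝[>] 0) (𝓝[≠] 0) := by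
    refine tendsto_nhdsWithin_iff.2 ⟨?_, ?_⟩
    · have : Tendsto (fun τ : ℝ => (τ : ℂ) * v) (𝓝 0) (𝓝 (((0 : ℝ) : ℂ) * v)) :=
        Continuous.tendsto (by fun_prop) 0
      rw [Complex.ofReal_zero, zero_mul] at this
      exact this.mono_left nhdsWithin_le_nhds
    · filter_upwards [self_mem_nhdsWithin] with τ hτ
      exact mul_ne_zero (by exact_mod_cast (ne_of_gt hτ)) hv
  refine hlim.frequently (Eventually.frequently ?_)
  filter_upwards [self_mem_nhdsWithin] with τ hτ
  have h1 : (affine e (τ * v)).re = e.1.re + τ * (e.2 * v).re := by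
    rw [affine, mul_left_comm, Complex.add_re, Complex.re_ofReal_mul]
  rw [h1]
  have := mul_nonpos_of_nonneg_of_nonpos (le_of_lt hτ) hve
  linarith

/-- Distinct affine functions take distinct values near `0`, except possibly at `0`. -/
theorem eventually_affine_ne {e e' : ℂ × ℂ} (h : e ≠ e') :
    ∀ᶠ ε in 𝓝[≠] (0 : ℂ), affine e ε ≠ affine e' ε := by
  by_cases h1 : e.1 = e'.1
  · have h2 : e.2 ≠ e'.2 := fun h2 => h (Prod.ext h1 h2)
    filter_upwards [self_mem_nhdsWithin] with ε hε heq
    simp only [affine, h1, add_right_inj] at heq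
    exact h2 (mul_right_cancel₀ hε heq)
  · refine Filter.Eventually.filter_mono nhdsWithin_le_nhds ?_
    have hc : Continuous fun ε => affine e ε - affine e' ε := by unfold affine; fun_prop
    have : (fun ε => affine e ε - affine e' ε) 0 ≠ 0 := by
      simpa [affine, sub_eq_zero] using h1
    filter_upwards [hc.continuousAt.eventually_ne this] with ε hε
    exact sub_ne_zero.1 hε

/-- Absolute convergence near `ε = 0` forces all exponents of `τ_ρ I` to have positive real part at
`ε = 0`. -/
theorem re_pos_of_integrable
    (hint : ∀ᶠ ε in 𝓝 (0 : ℂ), Integrable (fun α => I.eval α ε) (canonicalMeasure n))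
    {ρ : Fin n → ℝ} (hρ : ρ ≠ 0) {e₀ : ℂ × ℂ} (he₀ : e₀ ∈ I.exponents ρ) : 0 < e₀.1.re := by
  by_contra hre
  rw [not_lt] at hre
  obtain ⟨M, hM1, hM⟩ := I.exists_cutoff ρ
  obtain ⟨E, hE, hO⟩ := I.exists_isBigO_tau ρ hM
  have he₀E : e₀ ∈ E := (hE e₀).2 ⟨he₀, by linarith⟩
  have hμ : ∀ᶠ ε in 𝓝 (0 : ℂ), ∀ i, (1 / 2 : ℝ) ≤ M - (((I.term i).trop ρ).2 * ε).re := by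
    refine eventually_all.2 fun i => ?_
    have hc : Continuous fun ε : ℂ => M - (((I.term i).trop ρ).2 * ε).re := by fun_prop
    have h0 : (1 / 2 : ℝ) < (fun ε : ℂ => M - (((I.term i).trop ρ).2 * ε).re) 0 := by
      simp only [mul_zero, Complex.zero_re, sub_zero]
      linarith
    exact (hc.continuousAt.eventually_const_lt h0).mono fun ε hε => hε.le
  have hsep : ∀ᶠ ε in 𝓝[≠] (0 : ℂ), ∀ e ∈ E, e ≠ e₀ → affine e ε ≠ affine e₀ ε := by
    refine (Finset.eventually_all E).2 fun e _ => ?_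
    by_cases h : e = e₀
    · exact Eventually.of_forall fun ε h' => absurd h h'
    · exact (eventually_affine_ne h).mono fun ε hε _ => hε
  have hfreq : ∃ᶠ ε in 𝓝[≠] (0 : ℂ), ∀ x, I.tauCoeff ρ e₀ (expMap x) ε = 0 := by
    refine ((frequently_re_affine_nonpos hre).and_eventually
      (((hint.and hμ).filter_mono nhdsWithin_le_nhds).and hsep)).mono ?_
    rintro ε ⟨h1, ⟨h2, h3⟩, h4⟩ x
    exact I.tauCoeff_eq_zero_of_integrable hρ h2 he₀E h1 h4 one_half_pos
      (fun x => hO x ε _ h3) x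
  obtain ⟨x, ε, hne⟩ := I.mem_exponents_iff.1 he₀
  have hd : Differentiable ℂ fun ε => I.tauCoeff ρ e₀ (expMap x) ε :=
    (I.tauCoeff_mem_coeffAlgebra ρ e₀).2 x
  refine hne ?_
  exact (Complex.analyticOnNhd_univ_iff_differentiable.2 hd)
    |>.eqOn_zero_of_preconnected_of_frequently_eq_zero isPreconnected_univ (Set.mem_univ 0)
      (hfreq.mono fun ε h => h x) (Set.mem_univ ε)

end Combination

/-! ### Decay of combinations on a cone -/

section Cone

variable {ι : Type*}

/-- The coordinates `λ_k = exp (-t_k)` on a cone. -/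
noncomputable def expNeg (t : ι → ℝ≥0) : ι → ℂ := fun k => ((Real.exp (-(t k : ℝ)) : ℝ) : ℂ)

theorem expNeg_mem (r : ℝ) (t : ι → ℝ≥0) (k : ι) : expNeg t k ∈ discInterval r := by
  refine Or.inr ⟨_, ⟨(Real.exp_pos _).le, ?_⟩, rfl⟩
  exact Real.exp_le_one_iff.2 (neg_nonpos.2 (t k).2)

variable [DecidableEq ι]

/-- Translation by the unit vector in direction `k`. -/
def shift (k : ι) (t : ι → ℝ≥0) : ι → ℝ≥0 := t + Pi.single k 1

theorem shift_comm (k l : ι) (t : ι → ℝ≥0) : shift k (shift l t) = shift l (shift k t) :=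
  add_right_comm _ _ _

theorem expNeg_shift (k : ι) (t : ι → ℝ≥0) :
    expNeg (shift k t) = Function.update (expNeg t) k ((Real.exp (-1) : ℝ) * expNeg t k) := by
  ext l
  by_cases h : l = k
  · subst h
    simp only [expNeg, shift, Pi.add_apply, Pi.single_eq_same, Function.update_self,
      ← Complex.ofReal_mul, ← Real.exp_add]
    push_cast
    ring_nf
  · simp [expNeg, shift, h]

theorem update_mem_discInterval {r : ℝ} {z : ι → ℂ} (hz : ∀ l, z l ∈ discInterval r) {k : ι} {w : ℂ}
    (hw : w ∈ discInterval r) : ∀ l, Function.update z k w l ∈ discInterval r := by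
  intro l
  by_cases h : l = k
  · subst h; simpa using hw
  · simpa [h] using hz l

/-- Difference operators are linear. -/
theorem foldl_diffOp_sum {κ : Type*} (s : Finset κ) (c : κ → ℂ) (l : List (ι × ℂ)) :
    ∀ v : κ → (ι → ℝ≥0) → ℂ, l.foldl (fun v p => diffOp shift p v) (fun t => ∑ i ∈ s, c i * v i t) =
      fun t => ∑ i ∈ s, c i * l.foldl (fun v p => diffOp shift p v) (v i) t := by
  induction l with
  | nil => intro v; rfl
  | cons p l ih =>
    intro v
    rw [List.foldl_cons]
    have : diffOp shift p (fun t => ∑ i ∈ s, c i * v i t) =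
        fun t => ∑ i ∈ s, c i * diffOp shift p (v i) t := by
      ext t
      simp only [diffOp, Finset.mul_sum, ← Finset.sum_sub_distrib]
      exact Finset.sum_congr rfl fun i _ => by ring
    rw [this, ih]
    rfl

variable [Fintype ι]

/-- `G` is holomorphic near `0` in each coordinate, the others being fixed, and it is bounded by
`B ∏ l, |z_l| ^ j_l`, on the product of copies of `discInterval r`. -/
def VanishesTo (r B : ℝ) (j : ι → ℕ) (G : (ι → ℂ) → ℂ) : Prop :=
  (∀ z : ι → ℂ, (∀ l, z l ∈ discInterval r) → ∀ k,
    DifferentiableOn ℂ (fun w => G (Function.update z k w)) (Metric.ball 0 r)) ∧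
  ∀ z : ι → ℂ, (∀ l, z l ∈ discInterval r) → ‖G z‖ ≤ B * ∏ l, ‖z l‖ ^ j l

variable {r B : ℝ} {j : ι → ℕ} {G : (ι → ℂ) → ℂ}

theorem VanishesTo.mono (h : VanishesTo r B j G) (hr : r ≤ 1) (hB : 0 ≤ B) {j' : ι → ℕ}
    (hj : ∀ k, j' k ≤ j k) : VanishesTo r B j' G := by
  refine ⟨h.1, fun z hz => (h.2 z hz).trans ?_⟩
  refine mul_le_mul_of_nonneg_left (Finset.prod_le_prod (fun l _ => by positivity) fun l _ => ?_) hB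
  exact pow_le_pow_of_le_one (norm_nonneg _) (norm_le_one_of_mem_discInterval hr (hz l)) (hj l)

theorem VanishesTo.mono_const (h : VanishesTo r B j G) {B' : ℝ} (hB : B ≤ B') :
    VanishesTo r B' j G :=
  ⟨h.1, fun z hz => (h.2 z hz).trans (by gcongr)⟩

theorem exp_neg_one_le_one : Real.exp (-1) ≤ 1 := Real.exp_le_one_iff.2 (by norm_num)

theorem VanishesTo.differentiableOn_dilation (h : VanishesTo r B j G) (a m : ℂ) (k : ι)
    {z : ι → ℂ} (hz : ∀ l, z l ∈ discInterval r) (k' : ι) :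
    DifferentiableOn ℂ (fun w => (fun z : ι → ℂ => a * G (Function.update z k
      ((Real.exp (-1) : ℝ) * z k)) - m * G z) (Function.update z k' w)) (Metric.ball 0 r) := by
  refine DifferentiableOn.sub ?_ ((h.1 z hz k').const_mul m)
  refine DifferentiableOn.const_mul ?_ a
  by_cases hk : k = k'
  · subst hk
    simp only [Function.update_self, Function.update_idem]
    refine (h.1 z hz k).comp (f := fun w : ℂ => ((Real.exp (-1) : ℝ) : ℂ) * w) (by fun_prop) ?_
    intro w hw
    rw [mem_ball_zero_iff] at hw ⊢
    rw [norm_mul, Complex.norm_real, Real.norm_of_nonneg (Real.exp_pos _).le]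
    exact (mul_le_of_le_one_left (norm_nonneg _) exp_neg_one_le_one).trans_lt hw
  · simp only [Function.update_of_ne hk]
    simp only [Function.update_comm (Ne.symm hk)]
    exact h.1 _ (update_mem_discInterval hz (mul_mem_discInterval (Real.exp_pos _).le
      exp_neg_one_le_one (hz k))) k'

theorem VanishesTo.dilation (h : VanishesTo r B j G) (hB : 0 ≤ B) (a m : ℂ) (k : ι) :
    VanishesTo r ((‖a‖ + ‖m‖) * B) j
      (fun z => a * G (Function.update z k ((Real.exp (-1) : ℝ) * z k)) - m * G z) := by
  refine ⟨fun z hz k' => h.differentiableOn_dilation a m k hz k', fun z hz => ?_⟩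
  have hz' := update_mem_discInterval (k := k) hz
    (mul_mem_discInterval (Real.exp_pos (-1)).le exp_neg_one_le_one (hz k))
  have h1 : ‖G (Function.update z k ((Real.exp (-1) : ℝ) * z k))‖ ≤ B * ∏ l, ‖z l‖ ^ j l := by
    refine (h.2 _ hz').trans ?_
    gcongr with l
    by_cases hl : l = k
    · subst hl
      rw [Function.update_self, norm_mul, Complex.norm_real,
        Real.norm_of_nonneg (Real.exp_pos _).le]
      exact mul_le_of_le_one_left (norm_nonneg _) exp_neg_one_le_one
    · rw [Function.update_of_ne hl]
  calc _ ≤ ‖a‖ * (B * ∏ l, ‖z l‖ ^ j l) + ‖m‖ * (B * ∏ l, ‖z l‖ ^ j l) := by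
        refine (norm_sub_le _ _).trans ?_
        rw [norm_mul, norm_mul]
        gcongr
        exact h.2 z hz
    _ = _ := by ring

/-- The dilation difference that cancels the leading coefficient in direction `k` raises the order
of vanishing in that direction. -/
theorem VanishesTo.dilation_succ (h : VanishesTo r B j G) (hr : 0 < r) (a : ℂ) (k : ι) :
    VanishesTo r (‖a‖ * (2 * B / r)) (Function.update j k (j k + 1))
      (fun z => a * G (Function.update z k ((Real.exp (-1) : ℝ) * z k)) -
        a * ((Real.exp (-1) : ℝ) : ℂ) ^ j k * G z) := by
  refine ⟨fun z hz k' => h.differentiableOn_dilation a _ k hz k', fun z hz => ?_⟩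
  have hprod : ∀ (w : ℂ) (j' : ι → ℕ), ∏ l, ‖Function.update z k w l‖ ^ j' l =
      (∏ l ∈ Finset.univ.erase k, ‖z l‖ ^ j' l) * ‖w‖ ^ j' k := by
    intro w j'
    rw [← Finset.prod_erase_mul _ _ (Finset.mem_univ k), Function.update_self]
    refine congrArg₂ (· * ·) (Finset.prod_congr rfl fun l hl => ?_) rfl
    rw [Function.update_of_ne (Finset.ne_of_mem_erase hl)]
  have h1 := norm_dilation_sub_le (g := fun w => G (Function.update z k w))
    (A := B * ∏ l ∈ Finset.univ.erase k, ‖z l‖ ^ j l) (j := j k) hr (Real.exp_pos (-1))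
    exp_neg_one_le_one (h.1 z hz k) (fun w hw => by
      refine (h.2 _ (update_mem_discInterval hz hw)).trans_eq ?_
      rw [hprod]
      ring) (hz k)
  rw [Function.update_eq_self] at h1
  have h2 : ∏ l, ‖z l‖ ^ Function.update j k (j k + 1) l =
      (∏ l ∈ Finset.univ.erase k, ‖z l‖ ^ j l) * ‖z k‖ ^ (j k + 1) := by
    rw [← Finset.prod_erase_mul _ _ (Finset.mem_univ k), Function.update_self]
    refine congrArg₂ (· * ·) (Finset.prod_congr rfl fun l hl => ?_) rfl
    rw [Function.update_of_ne (Finset.ne_of_mem_erase hl)]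
  beta_reduce
  rw [mul_assoc a, ← mul_sub, norm_mul, h2]
  calc _ ≤ ‖a‖ * (2 * (B * ∏ l ∈ Finset.univ.erase k, ‖z l‖ ^ j l) / r * ‖z k‖ ^ (j k + 1)) := by
        gcongr
    _ = _ := by ring

/-- The function `exp (∑ k, t_k T_k) G (exp (-t))` on a cone. -/
noncomputable def coneTerm (T : ι → ℂ) (G : (ι → ℂ) → ℂ) (t : ι → ℝ≥0) : ℂ :=
  Complex.exp (∑ k, (t k : ℂ) * T k) * G (expNeg t)

theorem diffOp_coneTerm (T : ι → ℂ) (G : (ι → ℂ) → ℂ) (k : ι) (m : ℂ) :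
    diffOp shift (k, m) (coneTerm T G) = coneTerm T fun z =>
      Complex.exp (T k) * G (Function.update z k ((Real.exp (-1) : ℝ) * z k)) - m * G z := by
  ext t
  have h1 : ∑ l, ((shift k t l : ℝ≥0) : ℂ) * T l = ∑ l, (t l : ℂ) * T l + T k := by
    have : ∀ l, ((shift k t l : ℝ≥0) : ℂ) * T l =
        (t l : ℂ) * T l + if l = k then T l else 0 := by
      intro l
      by_cases hl : l = k
      · subst hl; simp [shift, add_mul]
      · simp [shift, hl]
    simp [this, Finset.sum_add_distrib]
  simp only [diffOp, coneTerm, h1, expNeg_shift, Complex.exp_add]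
  ring

/-- `v` is `exp (∑ k, t_k T_k) G (exp (-t))` with `G` separately holomorphic near `0` and bounded by
`B ∏ l, |z_l| ^ j_l`. -/
def IsConeTerm (T : ι → ℂ) (r B : ℝ) (j : ι → ℕ) (v : (ι → ℝ≥0) → ℂ) : Prop :=
  ∃ G, VanishesTo r B j G ∧ v = coneTerm T G

variable {T : ι → ℂ} {Λ : ℝ} {v : (ι → ℝ≥0) → ℂ}

theorem IsConeTerm.diffOp (h : IsConeTerm T r B j v) (hr : 0 < r) (hr1 : r ≤ 1) (hB : 0 ≤ B)
    (hT : ∀ k, ‖Complex.exp (T k)‖ ≤ Λ) {p : ι × ℂ} (hm : ‖p.2‖ ≤ Λ) :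
    IsConeTerm T r (2 * Λ / r * B) j (diffOp shift p v) := by
  obtain ⟨G, hG, rfl⟩ := h
  obtain ⟨k, m⟩ := p
  refine ⟨_, (hG.dilation hB (Complex.exp (T k)) m k).mono_const ?_, diffOp_coneTerm T G k m⟩
  gcongr
  have h0 : 0 ≤ Λ := (norm_nonneg _).trans hm
  calc _ ≤ Λ + Λ := add_le_add (hT k) hm
    _ = 2 * Λ := by ring
    _ ≤ 2 * Λ / r := le_div_self (by positivity) hr hr1

/-- Arbitrary difference operators preserve the order of vanishing. -/
theorem IsConeTerm.foldl_diffOp (hr : 0 < r) (hr1 : r ≤ 1)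
    (hT : ∀ k, ‖Complex.exp (T k)‖ ≤ Λ) (hΛ : 0 ≤ Λ) (l : List (ι × ℂ)) :
    ∀ {B : ℝ} {v : (ι → ℝ≥0) → ℂ}, 0 ≤ B → (∀ p ∈ l, ‖p.2‖ ≤ Λ) → IsConeTerm T r B j v →
    IsConeTerm T r ((2 * Λ / r) ^ l.length * B) j
      (l.foldl (fun v p => Euler.diffOp shift p v) v) := by
  induction l with
  | nil => intro B v _ _ h; simpa using h
  | cons p l ih =>
    intro B v hB hl h
    have h1 := ih (by positivity) (fun p' hp' => hl p' (List.mem_cons_of_mem _ hp'))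
      (h.diffOp hr hr1 hB hT (hl p List.mem_cons_self))
    simp only [List.length_cons, List.foldl_cons, pow_succ]
    rwa [mul_assoc]

/-- The difference operators that cancel the Taylor coefficients of order less than `M` in
direction `k`. -/
noncomputable def killList (T : ι → ℂ) (k : ι) (M : ℕ) : List (ι × ℂ) :=
  (List.range M).map fun d : ℕ => (k, Complex.exp (T k - d))

/-- `killList` makes the order of vanishing in direction `k` at least `M`, whatever it was
before. -/
theorem IsConeTerm.foldl_killList (h : IsConeTerm T r B j v) (hr : 0 < r) (hr1 : r ≤ 1)
    (hB : 0 ≤ B) (hT : ∀ k, ‖Complex.exp (T k)‖ ≤ Λ) (hΛ : 0 ≤ Λ) (k : ι) (M : ℕ) :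
    IsConeTerm T r ((2 * Λ / r) ^ (killList T k M).length * B) (Function.update j k M)
      ((killList T k M).foldl (fun v p => Euler.diffOp shift p v) v) := by
  induction M with
  | zero =>
    obtain ⟨G, hG, rfl⟩ := h
    refine ⟨G, ?_, by simp [killList]⟩
    simp only [killList, List.range_zero, List.map_nil, List.length_nil, pow_zero, one_mul]
    refine hG.mono hr1 hB fun l => ?_
    by_cases hl : l = k
    · subst hl; simp
    · simp [hl]
  | succ M ih =>
    obtain ⟨G, hG, hv⟩ := ih
    have h1 : killList T k (M + 1) = killList T k M ++ [(k, Complex.exp (T k - M))] := by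
      simp [killList, List.range_succ]
    have hlen : (killList T k M).length = M := by simp [killList]
    rw [h1, List.foldl_append, hv, List.length_append, hlen]
    simp only [List.foldl_cons, List.foldl_nil, List.length_cons, List.length_nil, zero_add,
      diffOp_coneTerm]
    have h2 : Complex.exp (T k - M) = Complex.exp (T k) * ((Real.exp (-1) : ℝ) : ℂ) ^ M := by
      rw [Complex.ofReal_exp, ← Complex.exp_nat_mul, ← Complex.exp_add]
      push_cast
      ring_nf
    rw [hlen] at hG
    have h3 := hG.dilation_succ hr (Complex.exp (T k)) k
    simp only [Function.update_self, Function.update_idem] at h3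
    refine ⟨_, h3.mono_const ?_, by rw [h2]⟩
    calc _ ≤ Λ * (2 * ((2 * Λ / r) ^ M * B) / r) := by gcongr; exact hT k
      _ = _ := by rw [pow_succ]; ring

/-- Applying `killList` in several directions, one after the other, makes the order of vanishing in
each of these directions at least `M k`. -/
theorem IsConeTerm.foldl_flatMap_killList (hr : 0 < r) (hr1 : r ≤ 1)
    (hT : ∀ k, ‖Complex.exp (T k)‖ ≤ Λ) (hΛ : 0 ≤ Λ) (M : ι → ℕ) (ks : List ι) :
    ∀ {B : ℝ} {j : ι → ℕ} {v : (ι → ℝ≥0) → ℂ}, 0 ≤ B → IsConeTerm T r B j v →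
    ∃ j' : ι → ℕ, (∀ k ∈ ks, j' k = M k) ∧ (∀ k, k ∉ ks → j' k = j k) ∧
      IsConeTerm T r ((2 * Λ / r) ^ (ks.flatMap fun k => killList T k (M k)).length * B) j'
      ((ks.flatMap fun k => killList T k (M k)).foldl (fun v p => Euler.diffOp shift p v) v) := by
  induction ks with
  | nil => intro B j v _ h; exact ⟨j, by simp, by simp, by simpa using h⟩
  | cons k ks ih =>
    intro B j v hB h
    obtain ⟨j', h1, h2, h3⟩ := ih (by positivity) (h.foldl_killList hr hr1 hB hT hΛ k (M k))
    refine ⟨j', fun l hl => ?_, fun l hl => ?_, ?_⟩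
    · by_cases hlk : l ∈ ks
      · exact h1 l hlk
      · obtain rfl : l = k := (List.mem_cons.1 hl).resolve_right hlk
        rw [h2 l hlk, Function.update_self]
    · rw [List.mem_cons, not_or] at hl
      rw [h2 l hl.2, Function.update_of_ne hl.1]
    · rw [List.flatMap_cons, List.length_append, List.foldl_append, pow_add]
      rwa [mul_comm ((2 * Λ / r) ^ _), mul_assoc]

theorem IsConeTerm.norm_le (h : IsConeTerm T r B j v) (hB : 0 ≤ B) {δ : ℝ}
    (hδ : ∀ k, δ ≤ j k - (T k).re) (t : ι → ℝ≥0) :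
    ‖v t‖ ≤ B * Real.exp (-(δ * ∑ k, (t k : ℝ))) := by
  obtain ⟨G, hG, rfl⟩ := h
  have h1 := hG.2 (expNeg t) (expNeg_mem r t)
  have h2 : ∏ l, ‖expNeg t l‖ ^ j l = Real.exp (-∑ l, (t l : ℝ) * j l) := by
    rw [← Finset.sum_neg_distrib, Real.exp_sum]
    refine Finset.prod_congr rfl fun l _ => ?_
    rw [expNeg, Complex.norm_real, Real.norm_of_nonneg (Real.exp_pos _).le, ← Real.exp_nat_mul]
    ring_nf
  rw [coneTerm, norm_mul, Complex.norm_exp]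
  calc _ ≤ Real.exp (∑ k, (t k : ℂ) * T k).re * (B * Real.exp (-∑ l, (t l : ℝ) * j l)) := by
        rw [← h2]; gcongr
    _ = B * Real.exp (∑ k, (t k : ℝ) * ((T k).re - j k)) := by
        rw [mul_left_comm, ← Real.exp_add, Complex.re_sum, ← sub_eq_add_neg,
          ← Finset.sum_sub_distrib]
        congr 2
        refine Finset.sum_congr rfl fun k _ => ?_
        have : ((t k : ℂ) * T k).re = (t k : ℝ) * (T k).re := Complex.re_ofReal_mul _ _
        rw [this]
        ring
    _ ≤ _ := by
        gcongr
        rw [Finset.mul_sum, ← Finset.sum_neg_distrib]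
        refine Finset.sum_le_sum fun k _ => ?_
        have := mul_le_mul_of_nonneg_left (hδ k) (t k).2
        change (t k : ℝ) * _ ≤ (t k : ℝ) * _ at this
        nlinarith

/-- A combination of terms `exp (∑ k, t_k T_k) G (exp (-t))` that decays exponentially in each
direction of the cone decays exponentially on the cone, uniformly: the difference operators which
cancel the Taylor coefficients of low order make each term small, and they can be inverted on
decaying functions. No uniformity is needed in the decay along the separate directions. -/
theorem exists_norm_sum_coneTerm_le {s : ℕ} (κ : Fin s → ℂ) (M : Fin s → ι → ℕ) {r B δ Λ μ : ℝ}
    (hr : 0 < r) (hr1 : r ≤ 1) (hB : 0 ≤ B) (hΛ : 0 ≤ Λ) (hμ : Real.exp (-δ) < μ) :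
    ∃ C : ℝ, 0 ≤ C ∧ ∀ (T : Fin s → ι → ℂ) (G : Fin s → (ι → ℂ) → ℂ),
      (∀ i, VanishesTo r B 0 (G i)) → (∀ i k, ‖Complex.exp (T i k)‖ ≤ Λ) →
      (∀ i k, δ ≤ M i k - (T i k).re) → (∀ i k, ∀ d < M i k, μ ≤ ‖Complex.exp (T i k - d)‖) →
      (∀ k t, ∃ K, ∀ j : ℕ,
        ‖∑ i, κ i * coneTerm (T i) (G i) ((shift k)^[j] t)‖ ≤ K * Real.exp (-δ) ^ j) →
      ∀ t, ‖∑ i, κ i * coneTerm (T i) (G i) t‖ ≤ C * Real.exp (-(δ * ∑ k, (t k : ℝ))) := by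
  set N := ((List.finRange s).map fun i =>
    ((Finset.univ.toList (α := ι)).map fun k => M i k).sum).sum with hN
  have hpos : 0 < μ - Real.exp (-δ) := by linarith
  refine ⟨(∑ i, ‖κ i‖ * ((2 * Λ / r) ^ N * B)) / (μ - Real.exp (-δ)) ^ N, by positivity,
    fun T G hG hT hδ hm hdec t => ?_⟩
  -- for each term, the operators that cancel its own low order Taylor coefficients
  set block : Fin s → List (ι × ℂ) := fun i =>
    (Finset.univ.toList (α := ι)).flatMap fun k => killList (T i) k (M i k) with hblock
  set l : List (ι × ℂ) := (List.finRange s).flatMap block with hl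
  have hlen : l.length = N := by
    simp [hl, hblock, hN, List.length_flatMap, killList]
  have hmem : ∀ p ∈ l, ∃ i k, ∃ d < M i k, p.2 = Complex.exp (T i k - d) := by
    intro p hp
    simp only [hl, hblock, killList, List.mem_flatMap, List.mem_map, List.mem_range] at hp
    obtain ⟨i, -, k, -, d, hd, rfl⟩ := hp
    exact ⟨i, k, d, hd, rfl⟩
  have hle : ∀ p ∈ l, ‖p.2‖ ≤ Λ := by
    intro p hp
    obtain ⟨i, k, d, -, h⟩ := hmem p hp
    refine le_trans ?_ (hT i k)
    rw [h, Complex.norm_exp, Complex.norm_exp]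
    exact Real.exp_le_exp.2 (by simp)
  have hterm : ∀ i t, ‖l.foldl (fun v p => diffOp shift p v) (coneTerm (T i) (G i)) t‖ ≤
      (2 * Λ / r) ^ N * B * Real.exp (-(δ * ∑ k, (t k : ℝ))) := by
    intro i t
    obtain ⟨l₁, l₂, h12⟩ := List.append_of_mem (List.mem_finRange i)
    have hl12 : l = l₁.flatMap block ++ (block i ++ l₂.flatMap block) := by
      rw [hl, h12, List.flatMap_append, List.flatMap_cons]
    have h0 : IsConeTerm (T i) r B 0 (coneTerm (T i) (G i)) := ⟨G i, hG i, rfl⟩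
    -- the operators of the other terms do no harm, whether they come before or after
    have h1 := IsConeTerm.foldl_diffOp hr hr1 (hT i) hΛ (l₁.flatMap block) hB
      (fun p hp => hle p (by rw [hl12]; exact List.mem_append_left _ hp)) h0
    obtain ⟨j, hj, -, h2⟩ := IsConeTerm.foldl_flatMap_killList hr hr1 (hT i) hΛ (M i)
      (Finset.univ.toList (α := ι)) (by positivity) h1
    have h3 := IsConeTerm.foldl_diffOp hr hr1 (hT i) hΛ (l₂.flatMap block) (by positivity)
      (fun p hp => hle p (by
        rw [hl12]; exact List.mem_append_right _ (List.mem_append_right _ hp))) h2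
    have h4 := h3.norm_le (by positivity) (δ := δ) (fun k => by
      rw [hj k (Finset.mem_toList.2 (Finset.mem_univ k))]; exact hδ i k) t
    rw [hl12, List.foldl_append, List.foldl_append]
    refine h4.trans_eq ?_
    rw [← hlen, hl12, List.length_append, List.length_append, pow_add, pow_add]
    ring
  have hfinal := norm_le_of_norm_foldl_diffOp_le (τ := shift (ι := ι)) shift_comm
    (W := fun t => Real.exp (-(δ * ∑ k, (t k : ℝ)))) (Real.exp_pos (-δ)).le hμ
    (fun k t => by
      have : ∑ l, ((shift k t l : ℝ≥0) : ℝ) = ∑ l, (t l : ℝ) + 1 := by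
        have h5 : ∀ l, ((shift k t l : ℝ≥0) : ℝ) = (t l : ℝ) + if l = k then 1 else 0 := by
          intro l
          by_cases hl : l = k
          · subst hl; simp [shift]
          · simp [shift, hl]
        simp [h5, Finset.sum_add_distrib]
      rw [this, ← Real.exp_add]
      exact Real.exp_le_exp.2 (by linarith))
    (fun t => (Real.exp_pos _).le) l
    (C := ∑ i, ‖κ i‖ * ((2 * Λ / r) ^ N * B)) (by positivity)
    (u := fun t => ∑ i, κ i * coneTerm (T i) (G i) t)
    (fun p hp => by
      obtain ⟨i, k, d, hd, h⟩ := hmem p hp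
      rw [h]
      exact hm i k d hd) hdec
    (fun t => by
      rw [foldl_diffOp_sum, Finset.sum_mul]
      refine (norm_sum_le _ _).trans (Finset.sum_le_sum fun i _ => ?_)
      rw [norm_mul, mul_assoc]
      gcongr
      exact hterm i t) t
  rwa [hlen] at hfinal

end Cone

/-! ### Euler integrands on a cone -/

section ConePoly

variable {n : ℕ} {ι : Type*} (P : PosPoly n) (φ : Fin n → ℤ) (ρ : ι → Fin n → ℤ)

/-- The exponent `φ` of `P` has the maximal pairing with every `ρ_k`. -/
def IsTopVertex : Prop :=
  φ ∈ P.coeff.support ∧ ∀ m ∈ P.coeff.support, ∀ k, 0 ≤ pairing (toReal (ρ k)) (φ - m)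

variable {P φ ρ} in
theorem IsTopVertex.trop_eq (h : IsTopVertex P φ ρ) (k : ι) :
    P.trop (toReal (ρ k)) = pairing (toReal (ρ k)) φ := by
  refine le_antisymm (Finset.sup'_le _ _ fun m hm => ?_) (P.pairing_le_trop _ h.1)
  have := h.2 m hm k
  rw [pairing_sub] at this
  linarith

variable [Fintype ι]

/-- The polynomial `α ^ (-φ) P(α)` in the coordinates `λ_k` on the cone generated by the `ρ_k`,
where `α = ∏ k, λ_k ^ (-ρ_k)`. The exponents `ρ_k · (φ - m)` are meant to be non-negative. -/
noncomputable def conePoly (z : ι → ℂ) : ℂ :=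
  ∑ m ∈ P.coeff.support, (P.coeff m : ℂ) * ∏ k, z k ^ (∑ i, ρ k i * (φ - m) i).toNat

/-- The point with coordinates `t` of the cone generated by the `ρ_k`. -/
noncomputable def conePoint (t : ι → ℝ≥0) : Fin n → ℝ := ∑ k, (t k : ℝ) • toReal (ρ k)

theorem pairing_conePoint (t : ι → ℝ≥0) (m : Fin n → ℤ) :
    pairing (conePoint ρ t) m = ∑ k, (t k : ℝ) * pairing (toReal (ρ k)) m := by
  rw [conePoint, pairing_sum_left]
  simp only [pairing_smul_left]

variable {P φ ρ}

theorem IsTopVertex.conePoly_expNeg (h : IsTopVertex P φ ρ) (t : ι → ℝ≥0) :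
    conePoly P φ ρ (expNeg t) =
      ((P.eval (expMap (conePoint ρ t)) * Real.exp (-pairing (conePoint ρ t) φ) : ℝ) : ℂ) := by
  rw [PosPoly.eval_expMap, Finset.sum_mul, conePoly]
  push_cast
  refine Finset.sum_congr rfl fun m hm => ?_
  rw [mul_assoc]
  congr 1
  rw [← Complex.ofReal_neg, ← Complex.ofReal_exp, ← Complex.ofReal_exp, ← Complex.ofReal_mul,
    ← Real.exp_add]
  have h1 : pairing (conePoint ρ t) m + -pairing (conePoint ρ t) φ =
      ∑ k, -((t k : ℝ) * pairing (toReal (ρ k)) (φ - m)) := by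
    rw [← sub_eq_add_neg, ← pairing_sub, pairing_conePoint]
    refine Finset.sum_congr rfl fun k _ => ?_
    rw [pairing_sub, pairing_sub]
    ring
  rw [h1, Real.exp_sum, Complex.ofReal_prod]
  refine Finset.prod_congr rfl fun k _ => ?_
  have h2 := h.2 m hm k
  rw [pairing_toReal] at h2 ⊢
  have h3 : 0 ≤ ∑ i, ρ k i * (φ - m) i := by exact_mod_cast h2
  have h4 : (((∑ i, ρ k i * (φ - m) i).toNat : ℕ) : ℝ) = ((∑ i, ρ k i * (φ - m) i : ℤ) : ℝ) := by
    rw [← Int.cast_natCast, Int.toNat_of_nonneg h3]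
  rw [expNeg, ← Complex.ofReal_pow, ← Real.exp_nat_mul, h4]
  ring_nf

theorem norm_prod_pow_le {r : ℝ} (hr1 : r ≤ 1) {z : ι → ℂ} (hz : ∀ l, z l ∈ discInterval r)
    (d : ι → ℕ) : ‖∏ k, z k ^ d k‖ ≤ 1 := by
  rw [norm_prod]
  refine Finset.prod_le_one (fun k _ => norm_nonneg _) fun k _ => ?_
  rw [norm_pow]
  exact pow_le_one₀ (norm_nonneg _) (norm_le_one_of_mem_discInterval hr1 (hz k))

/-- A monomial on the product of copies of `discInterval r` is either a non-negative real number or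
small. -/
theorem neg_le_re_prod_pow {r : ℝ} (hr : 0 < r) (hr1 : r ≤ 1) {z : ι → ℂ}
    (hz : ∀ l, z l ∈ discInterval r) (d : ι → ℕ) : -r ≤ (∏ k, z k ^ d k).re := by
  classical
  by_cases hex : ∃ k, d k ≠ 0 ∧ ‖z k‖ < r
  · obtain ⟨k, hdk, hzk⟩ := hex
    have h1 : ‖∏ k, z k ^ d k‖ ≤ r := by
      rw [← Finset.mul_prod_erase _ _ (Finset.mem_univ k), norm_mul, norm_pow]
      have h2 : ‖z k‖ ^ d k ≤ r := (pow_le_of_le_one (norm_nonneg _)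
        (norm_le_one_of_mem_discInterval hr1 (hz k)) hdk).trans hzk.le
      have h3 : ‖∏ l ∈ Finset.univ.erase k, z l ^ d l‖ ≤ 1 := by
        rw [norm_prod]
        refine Finset.prod_le_one (fun k _ => norm_nonneg _) fun k _ => ?_
        rw [norm_pow]
        exact pow_le_one₀ (norm_nonneg _) (norm_le_one_of_mem_discInterval hr1 (hz k))
      calc _ ≤ r * 1 := mul_le_mul h2 h3 (norm_nonneg _) hr.le
        _ = r := mul_one r
    exact (neg_le_neg h1).trans (neg_le_of_abs_le (Complex.abs_re_le_norm _))
  · push Not at hex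
    have h1 : ∀ k, ∃ y : ℝ, 0 ≤ y ∧ z k ^ d k = y := by
      intro k
      by_cases hdk : d k = 0
      · exact ⟨1, zero_le_one, by simp [hdk]⟩
      · rcases hz k with h | ⟨y, hy, hyz⟩
        · exact absurd (mem_ball_zero_iff.1 h) (not_lt.2 (hex k hdk))
        · exact ⟨y ^ d k, pow_nonneg hy.1 _, by rw [← hyz]; push_cast; rfl⟩
    choose y hy0 hy using h1
    rw [Finset.prod_congr rfl fun k _ => hy k, ← Complex.ofReal_prod, Complex.ofReal_re]
    exact le_trans (by linarith) (Finset.prod_nonneg fun k _ => hy0 k)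

theorem norm_conePoly_le {r : ℝ} (hr1 : r ≤ 1) {z : ι → ℂ} (hz : ∀ l, z l ∈ discInterval r) :
    ‖conePoly P φ ρ z‖ ≤ ∑ m ∈ P.coeff.support, P.coeff m := by
  refine (norm_sum_le _ _).trans (Finset.sum_le_sum fun m _ => ?_)
  rw [norm_mul, Complex.norm_real, Real.norm_of_nonneg (P.nonneg m)]
  exact mul_le_of_le_one_right (P.nonneg m) (norm_prod_pow_le hr1 hz _)

theorem le_re_conePoly (hφ : φ ∈ P.coeff.support) {r : ℝ} (hr : 0 < r) (hr1 : r ≤ 1)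
    (hrP : r * ∑ m ∈ P.coeff.support, P.coeff m ≤ P.coeff φ / 2)
    {z : ι → ℂ} (hz : ∀ l, z l ∈ discInterval r) :
    P.coeff φ / 2 ≤ (conePoly P φ ρ z).re := by
  classical
  have h1 : ∀ m, ((P.coeff m : ℂ) * ∏ k, z k ^ (∑ i, ρ k i * (φ - m) i).toNat).re =
      P.coeff m * (∏ k, z k ^ (∑ i, ρ k i * (φ - m) i).toNat).re := fun m =>
    Complex.re_ofReal_mul _ _
  have h2 : -(r * ∑ m ∈ P.coeff.support.erase φ, P.coeff m) ≤
      ∑ m ∈ P.coeff.support.erase φ,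
        ((P.coeff m : ℂ) * ∏ k, z k ^ (∑ i, ρ k i * (φ - m) i).toNat).re := by
    rw [Finset.mul_sum, ← Finset.sum_neg_distrib]
    refine Finset.sum_le_sum fun m _ => ?_
    rw [h1]
    have := mul_le_mul_of_nonneg_left (neg_le_re_prod_pow hr hr1 hz
      fun k => (∑ i, ρ k i * (φ - m) i).toNat) (P.nonneg m)
    linarith
  rw [← Finset.add_sum_erase _ _ hφ] at hrP
  rw [conePoly, Complex.re_sum, ← Finset.add_sum_erase _ _ hφ, h1]
  simp only [sub_self, Pi.zero_apply, mul_zero, Finset.sum_const_zero, Int.toNat_zero, pow_zero,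
    Finset.prod_const_one, Complex.one_re, mul_one]
  have := mul_nonneg hr.le (P.nonneg φ)
  linarith

theorem differentiable_conePoly : Differentiable ℂ (conePoly P φ ρ) := by
  unfold conePoly
  fun_prop

end ConePoly

theorem norm_cpow_le {Q c : ℂ} {a b : ℝ} (ha : 0 < a) (hQa : a ≤ Q.re) (hQb : ‖Q‖ ≤ b) :
    ‖Q ^ c‖ ≤ Real.exp ((|Real.log a| + |Real.log b| + Real.pi) * ‖c‖) := by
  have hQ : 0 < ‖Q‖ := ha.trans_le (hQa.trans (Complex.re_le_norm Q))
  rw [Complex.cpow_def_of_ne_zero (norm_pos_iff.1 hQ), Complex.norm_exp]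
  refine Real.exp_le_exp.2 ((Complex.re_le_norm _).trans ?_)
  rw [norm_mul]
  gcongr
  refine (Complex.norm_le_abs_re_add_abs_im _).trans ?_
  rw [Complex.log_re, Complex.log_im]
  refine add_le_add ?_ (Complex.abs_arg_le_pi _)
  have h1 : Real.log a ≤ Real.log ‖Q‖ :=
    Real.log_le_log ha (hQa.trans (Complex.re_le_norm Q))
  have h2 : Real.log ‖Q‖ ≤ Real.log b := Real.log_le_log hQ hQb
  rw [abs_le]
  constructor
  · linarith [neg_abs_le (Real.log a), abs_nonneg (Real.log b)]
  · linarith [le_abs_self (Real.log b), abs_nonneg (Real.log a)]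

theorem norm_affine_le {e : ℂ × ℂ} {ε : ℂ} (hε : ‖ε‖ ≤ 1) : ‖affine e ε‖ ≤ ‖e.1‖ + ‖e.2‖ := by
  refine (norm_add_le _ _).trans (add_le_add le_rfl ?_)
  rw [norm_mul]
  exact mul_le_of_le_one_right (norm_nonneg _) hε

namespace Integrand

variable {n : ℕ} {ι : Type*} [Fintype ι] (I : Integrand n) (φ : Fin I.m → Fin n → ℤ)
  (ρ : ι → Fin n → ℤ)

/-- The factor of an Euler integrand, in the coordinates `λ_k` on a cone, that is regular at
`λ = 0`. -/
noncomputable def coneFactor (ε : ℂ) (z : ι → ℂ) : ℂ :=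
  ∏ j, conePoly (I.P j) (φ j) ρ z ^ affine (I.c j) ε

variable {I φ ρ}

/-- On the cone, an Euler integrand is `∏ k, λ_k ^ (-Trop I(ρ_k))` times its regular factor. -/
theorem eval_conePoint (h : ∀ j, IsTopVertex (I.P j) (φ j) ρ) (ε : ℂ) (t : ι → ℝ≥0) :
    I.eval (expMap (conePoint ρ t)) ε =
      coneTerm (fun k => affine (I.trop (toReal (ρ k))) ε) (I.coneFactor φ ρ ε) t := by
  have h1 : ∀ j, (((I.P j).eval (expMap (conePoint ρ t)) : ℝ) : ℂ) ^ affine (I.c j) ε =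
      Complex.exp ((pairing (conePoint ρ t) (φ j) : ℝ) * affine (I.c j) ε) *
        conePoly (I.P j) (φ j) ρ (expNeg t) ^ affine (I.c j) ε := by
    intro j
    have h2 := (I.P j).eval_expMap_pos (conePoint ρ t)
    rw [(h j).conePoly_expNeg, ← ofReal_exp_cpow, ← Complex.mul_cpow_ofReal_nonneg
      (Real.exp_pos _).le (by positivity), ← Complex.ofReal_mul, mul_left_comm, ← Real.exp_add]
    simp
  have h3 : ∀ i, ((expMap (conePoint ρ t) i : ℝ) : ℂ) ^ affine (I.ν i) ε =
      Complex.exp ((conePoint ρ t i : ℝ) * affine (I.ν i) ε) := fun i => ofReal_exp_cpow _ _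
  rw [eval, Finset.prod_congr rfl fun i _ => h3 i, Finset.prod_congr rfl fun j _ => h1 j,
    Finset.prod_mul_distrib, ← Complex.exp_sum, ← Complex.exp_sum, ← mul_assoc, ← Complex.exp_add,
    coneTerm, coneFactor]
  congr 2
  simp only [affine_trop, mul_add, Finset.sum_add_distrib, Finset.mul_sum]
  congr 1
  · rw [Finset.sum_comm]
    refine Finset.sum_congr rfl fun i _ => ?_
    rw [conePoint, Finset.sum_apply, Complex.ofReal_sum, Finset.sum_mul]
    refine Finset.sum_congr rfl fun k _ => ?_
    simp only [Pi.smul_apply, smul_eq_mul, Complex.ofReal_mul, mul_assoc]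
  · rw [Finset.sum_comm]
    refine Finset.sum_congr rfl fun j _ => ?_
    rw [pairing_conePoint, Complex.ofReal_sum, Finset.sum_mul]
    refine Finset.sum_congr rfl fun k _ => ?_
    rw [(h j).trop_eq, Complex.ofReal_mul, mul_assoc]

/-- A bound for the regular factor that is uniform in `|ε| ≤ 1`. -/
noncomputable def coneBound (I : Integrand n) (φ : Fin I.m → Fin n → ℤ) : ℝ :=
  ∏ j, Real.exp ((|Real.log ((I.P j).coeff (φ j) / 2)| +
    |Real.log (∑ m ∈ (I.P j).coeff.support, (I.P j).coeff m)| + Real.pi) *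
      (‖(I.c j).1‖ + ‖(I.c j).2‖))

theorem vanishesTo_coneFactor [DecidableEq ι] (h : ∀ j, IsTopVertex (I.P j) (φ j) ρ) {r : ℝ}
    (hr : 0 < r) (hr1 : r ≤ 1)
    (hrP : ∀ j, r * ∑ m ∈ (I.P j).coeff.support, (I.P j).coeff m ≤ (I.P j).coeff (φ j) / 2)
    {ε : ℂ} (hε : ‖ε‖ ≤ 1) :
    VanishesTo r (I.coneBound φ) 0 (I.coneFactor φ ρ ε) := by
  have hpos : ∀ j, 0 < (I.P j).coeff (φ j) / 2 := fun j => half_pos ((I.P j).coeff_pos (h j).1)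
  refine ⟨fun z hz k w hw => ?_, fun z hz => ?_⟩
  · refine DifferentiableAt.differentiableWithinAt ?_
    unfold coneFactor
    refine DifferentiableAt.fun_finsetProd fun j _ => ?_
    have hd : Differentiable ℂ fun w : ℂ => Function.update z k w := fun w =>
      (hasDerivAt_update z k w).differentiableAt
    refine DifferentiableAt.cpow_const
      ((differentiable_conePoly (P := I.P j) (φ := φ j) (ρ := ρ)).comp hd w) ?_
    refine Complex.mem_slitPlane_iff.2 (Or.inl ?_)
    exact (hpos j).trans_le (le_re_conePoly (h j).1 hr hr1 (hrP j)
      (update_mem_discInterval hz (Or.inl hw)))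
  · simp only [Pi.zero_apply, pow_zero, Finset.prod_const_one, mul_one]
    rw [coneFactor, norm_prod, coneBound]
    refine Finset.prod_le_prod (fun j _ => norm_nonneg _) fun j _ => ?_
    refine (norm_cpow_le (hpos j) (le_re_conePoly (h j).1 hr hr1 (hrP j) hz)
      (norm_conePoly_le hr1 hz)).trans (Real.exp_le_exp.2 ?_)
    have := norm_affine_le (e := I.c j) hε
    have := Real.pi_pos
    gcongr

end Integrand

namespace Combination

variable {n : ℕ} (I : Combination n)

/-! ### Sufficiency -/

/-- Exponential decay along a single ray. -/
theorem exists_norm_eval_ray_le {ρ : Fin n → ℝ} {δ : ℝ} (hδ0 : 0 < δ) (hδ1 : 2 * δ ≤ 1)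
    (hδ : ∀ e ∈ I.exponents ρ, 2 * δ ≤ e.1.re) {ε : ℂ}
    (hε : ∀ i, |(((I.term i).trop ρ).2 * ε).re| ≤ δ / 2) (x : Fin n → ℝ) :
    ∃ K : ℝ, ∀ j : ℕ, ‖I.eval (expMap (x + (j : ℝ) • ρ)) ε‖ ≤ K * Real.exp (-δ) ^ j := by
  obtain ⟨M, hM1, hM⟩ := I.exists_cutoff ρ
  obtain ⟨E, hE, hO⟩ := I.exists_isBigO_tau ρ hM
  have h1 := hO x ε δ fun i => by
    have := (abs_le.1 (hε i)).2
    linarith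
  have h2 : (fun t : ℝ => ∑ e ∈ E, I.tauCoeff ρ e (expMap x) ε * Complex.exp (-affine e ε * t))
      =O[atTop] fun t : ℝ => Real.exp (-δ * t) := by
    refine IsBigO.fun_sum fun e he => IsBigO.const_mul_left ?_ _
    have heI := ((hE e).1 he).1
    obtain ⟨i, hi⟩ := I.exists_snd_eq heI
    have h3 : δ ≤ (affine e ε).re := by
      have h4 := (abs_le.1 (hε i)).2
      rw [affine, hi, Complex.add_re, neg_mul, Complex.neg_re]
      linarith [hδ e heI]
    refine IsBigO.of_bound 1 ?_
    filter_upwards [eventually_ge_atTop 0] with t ht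
    rw [Complex.norm_exp, Real.norm_of_nonneg (Real.exp_pos _).le, one_mul]
    refine Real.exp_le_exp.2 ?_
    rw [Complex.re_mul_ofReal, Complex.neg_re]
    nlinarith
  have h5 : (fun t : ℝ => I.eval (expMap (x + t • ρ)) ε) =O[atTop]
      fun t : ℝ => Real.exp (-δ * t) := (h1.add h2).congr_left fun t => by ring
  obtain ⟨K, -, hK⟩ := bound_of_isBigO_nat_atTop (h5.comp_tendsto tendsto_natCast_atTop_atTop)
  refine ⟨K, fun j => ?_⟩
  have h6 := @hK j (Real.exp_pos _).ne'
  simp only [Function.comp_apply, Real.norm_of_nonneg (Real.exp_pos _).le] at h6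
  refine h6.trans_eq ?_
  rw [← Real.exp_nat_mul, mul_comm (j : ℝ)]

theorem eventually_two_mul_le {a : ℝ} (ha : 0 < a) : ∀ᶠ δ in 𝓝[>] (0 : ℝ), 2 * δ ≤ a := by
  refine Filter.Eventually.filter_mono nhdsWithin_le_nhds ?_
  filter_upwards [eventually_le_nhds (show (0 : ℝ) < a / 2 by positivity)] with δ hδ
  linarith

theorem eventually_mul_le {a b : ℝ} (ha : 0 < a) : ∀ᶠ r in 𝓝[>] (0 : ℝ), r * b ≤ a := by
  refine Filter.Eventually.filter_mono nhdsWithin_le_nhds ?_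
  have hc : ContinuousAt (fun r : ℝ => r * b) 0 := by fun_prop
  exact (hc.eventually_lt_const (by simpa using ha)).mono fun r hr => hr.le

theorem conePoint_iterate_shift {ι : Type*} [DecidableEq ι] [Fintype ι] (ρ : ι → Fin n → ℤ) (k : ι)
    (t : ι → ℝ≥0) (j : ℕ) :
    conePoint ρ ((shift k)^[j] t) = conePoint ρ t + (j : ℝ) • toReal (ρ k) := by
  induction j with
  | zero => simp
  | succ j ih =>
    rw [Function.iterate_succ_apply']
    have h1 : ∀ s : ι → ℝ≥0, conePoint ρ (shift k s) = conePoint ρ s + toReal (ρ k) := by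
      intro s
      have : ∀ l, ((shift k s l : ℝ≥0) : ℝ) • toReal (ρ l) =
          (s l : ℝ) • toReal (ρ l) + if l = k then toReal (ρ l) else 0 := by
        intro l
        by_cases hl : l = k
        · subst hl; simp [shift, add_smul]
        · simp [shift, hl]
      simp [conePoint, this, Finset.sum_add_distrib]
    rw [h1, ih, add_assoc]
    congr 1
    push_cast
    rw [add_smul, one_smul]

/-- If all exponents of the Puiseux series along the generators of a cone on which every
polynomial has a dominant monomial have positive real part, then the combination decays
exponentially on the cone, uniformly in small `ε`. -/
theorem exists_norm_eval_cone_le {ι : Type*} [DecidableEq ι] [Fintype ι] {ρ : ι → Fin n → ℤ}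
    {φ : ∀ i, Fin (I.term i).m → Fin n → ℤ}
    (h : ∀ i j, IsTopVertex ((I.term i).P j) (φ i j) ρ)
    (hpos : ∀ k, ∀ e ∈ I.exponents (toReal (ρ k)), 0 < e.1.re) :
    ∃ C δ : ℝ, 0 ≤ C ∧ 0 < δ ∧ ∀ᶠ ε in 𝓝 (0 : ℂ), ∀ t : ι → ℝ≥0,
      ‖I.eval (expMap (conePoint ρ t)) ε‖ ≤ C * Real.exp (-(δ * ∑ k, (t k : ℝ))) := by
  set T : Fin I.size → ι → ℂ × ℂ := fun i k => (I.term i).trop (toReal (ρ k)) with hT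
  -- the Taylor coefficients of order `< M i k` are those that belong to non-decaying terms
  set M : Fin I.size → ι → ℕ := fun i k => ⌊(T i k).1.re + 1⌋₊ with hM
  have hMlt : ∀ i k, (T i k).1.re < M i k := by
    intro i k
    have := Nat.lt_floor_add_one ((T i k).1.re + 1)
    simp only [hM]
    linarith
  have hMle : ∀ i k, ∀ d < M i k, (d : ℝ) ≤ (T i k).1.re := by
    intro i k d hd
    have h1 : (d + 1 : ℕ) ≤ ⌊(T i k).1.re + 1⌋₊ := hd
    have h2 := (Nat.le_floor_iff' (Nat.succ_ne_zero d)).1 h1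
    push_cast at h2
    linarith
  choose δ' hδ'0 hδ' using fun k => I.exists_pos_le_re (hpos k)
  obtain ⟨δ, hδ1, hδM, hδe, hδ0⟩ : ∃ δ : ℝ, 2 * δ ≤ 1 ∧
      (∀ i k, 2 * δ ≤ M i k - (T i k).1.re) ∧ (∀ k, 2 * δ ≤ δ' k) ∧ 0 < δ := by
    refine ((eventually_two_mul_le one_pos).and (Eventually.and ?_ (Eventually.and ?_
      (eventually_mem_of_tendsto_nhdsWithin tendsto_id)))).exists
    · exact eventually_all.2 fun i => eventually_all.2 fun k =>
        eventually_two_mul_le (sub_pos.2 (hMlt i k))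
    · exact eventually_all.2 fun k => eventually_two_mul_le (hδ'0 k)
  obtain ⟨r, hr1, hrP, hr0⟩ : ∃ r : ℝ, r * 1 ≤ 1 ∧
      (∀ i j, r * ∑ m ∈ ((I.term i).P j).coeff.support, ((I.term i).P j).coeff m ≤
        ((I.term i).P j).coeff (φ i j) / 2) ∧ 0 < r := by
    refine ((eventually_mul_le one_pos).and (Eventually.and ?_
      (eventually_mem_of_tendsto_nhdsWithin tendsto_id))).exists
    exact eventually_all.2 fun i => eventually_all.2 fun j =>
      eventually_mul_le (half_pos (((I.term i).P j).coeff_pos (h i j).1))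
  rw [mul_one] at hr1
  have hB0 : ∀ i, 0 ≤ (I.term i).coneBound (φ i) := fun i =>
    Finset.prod_nonneg fun j _ => (Real.exp_pos _).le
  set Λ := Real.exp (∑ i, ∑ k, (‖(T i k).1‖ + ‖(T i k).2‖)) with hΛ
  obtain ⟨C, hC0, hC⟩ := exists_norm_sum_coneTerm_le I.κ M (δ := δ) (μ := Real.exp (-(δ / 2)))
    (B := ∑ i, (I.term i).coneBound (φ i)) (Λ := Λ) hr0 hr1 (Finset.sum_nonneg fun i _ => hB0 i)
    (Real.exp_pos _).le (Real.exp_lt_exp.2 (by linarith))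
  refine ⟨C, δ, hC0, hδ0, ?_⟩
  have hε1 : ∀ᶠ ε in 𝓝 (0 : ℂ), ‖ε‖ ≤ 1 := by
    filter_upwards [Metric.closedBall_mem_nhds (0 : ℂ) one_pos] with ε hε
    simpa using hε
  have hεT : ∀ᶠ ε in 𝓝 (0 : ℂ), ∀ k i, |((T i k).2 * ε).re| ≤ δ / 2 := by
    refine eventually_all.2 fun k => eventually_all.2 fun i => ?_
    have hc : ContinuousAt (fun ε : ℂ => |((T i k).2 * ε).re|) 0 := by fun_prop
    exact (hc.eventually_lt_const (by simpa using half_pos hδ0)).mono fun ε hε => hε.le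
  filter_upwards [hε1, hεT] with ε h1 hT2 t
  have heval : ∀ t : ι → ℝ≥0, I.eval (expMap (conePoint ρ t)) ε = ∑ i, I.κ i *
      coneTerm (fun k => affine (T i k) ε) ((I.term i).coneFactor (φ i) ρ ε) t := by
    intro t
    rw [Combination.eval]
    exact Finset.sum_congr rfl fun i _ => by rw [Integrand.eval_conePoint (h i)]
  rw [heval]
  refine hC (fun i k => affine (T i k) ε) _ (fun i => ?_) (fun i k => ?_) (fun i k => ?_)
    (fun i k d hd => ?_) (fun k t => ?_) t
  · exact (Integrand.vanishesTo_coneFactor (h i) hr0 hr1 (hrP i) h1).mono_const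
      (Finset.single_le_sum (f := fun i => (I.term i).coneBound (φ i)) (fun i _ => hB0 i)
        (Finset.mem_univ i))
  · rw [Complex.norm_exp, hΛ]
    refine Real.exp_le_exp.2 ((Complex.re_le_norm _).trans ((norm_affine_le h1).trans ?_))
    have h2 := Finset.single_le_sum (f := fun k => ‖(T i k).1‖ + ‖(T i k).2‖)
      (fun k _ => by positivity) (Finset.mem_univ k)
    have h3 := Finset.single_le_sum (f := fun i => ∑ k, (‖(T i k).1‖ + ‖(T i k).2‖))
      (fun i _ => by positivity) (Finset.mem_univ i)
    exact h2.trans h3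
  · have h2 := (abs_le.1 (hT2 k i)).2
    simp only [affine, Complex.add_re]
    linarith [hδM i k]
  · rw [Complex.norm_exp]
    refine Real.exp_le_exp.2 ?_
    have h2 := (abs_le.1 (hT2 k i)).1
    simp only [affine, Complex.sub_re, Complex.add_re, Complex.natCast_re]
    linarith [hMle i k d hd]
  · obtain ⟨K, hK⟩ := I.exists_norm_eval_ray_le hδ0 hδ1
      (fun e he => (hδe k).trans (hδ' k e he)) (hT2 k) (conePoint ρ t)
    refine ⟨K, fun j => ?_⟩
    rw [← heval, conePoint_iterate_shift]
    exact hK j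

/-- Exponential decay on the cone of those `x` at which the chosen monomials `φ i j` of the
polynomials are dominant. -/
theorem exists_norm_eval_le (φ : ∀ i, ∀ j : Fin (I.term i).m, ((I.term i).P j).coeff.support)
    (hpos : ∀ ρ : Fin n → ℝ, ρ ≠ 0 → ∀ e ∈ I.exponents ρ, 0 < e.1.re) :
    ∃ C δ : ℝ, 0 ≤ C ∧ 0 < δ ∧ ∀ᶠ ε in 𝓝 (0 : ℂ), ∀ x : Fin n → ℝ,
      (∀ i j, ∀ m ∈ ((I.term i).P j).coeff.support, pairing x m ≤ pairing x (φ i j).1) →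
      ‖I.eval (expMap x) ε‖ ≤ C * Real.exp (-(δ * ∑ i, |x i|)) := by
  classical
  obtain ⟨V, hV, hgen⟩ := exists_generators (Finset.univ.biUnion fun i => Finset.univ.biUnion
    fun j => ((I.term i).P j).coeff.support.image fun m => (φ i j).1 - m)
  have hmem : ∀ v : Fin n → ℝ, (∀ m ∈ (Finset.univ.biUnion fun i => Finset.univ.biUnion
      fun j => ((I.term i).P j).coeff.support.image fun m => (φ i j).1 - m), 0 ≤ pairing v m) ↔
      ∀ i j, ∀ m ∈ ((I.term i).P j).coeff.support, 0 ≤ pairing v ((φ i j).1 - m) := by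
    intro v
    constructor
    · intro h i j m hm
      refine h _ ?_
      simp only [Finset.mem_biUnion, Finset.mem_univ, true_and, Finset.mem_image]
      exact ⟨i, j, m, hm, rfl⟩
    · intro h m' hm'
      simp only [Finset.mem_biUnion, Finset.mem_univ, true_and, Finset.mem_image] at hm'
      obtain ⟨i, j, m, hm, rfl⟩ := hm'
      exact h i j m hm
  obtain ⟨C, δ, hC, hδ, hbound⟩ := I.exists_norm_eval_cone_le (ι := V) (ρ := fun v => v.1)
    (φ := fun i j => (φ i j).1)
    (fun i j => ⟨(φ i j).2, fun m hm v => (hmem _).1 (hV v.1 v.2).2 i j m hm⟩)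
    (fun v => hpos _ fun h0 => (hV v.1 v.2).1 (funext fun i => by
      have := congrFun h0 i
      simpa [toReal] using this))
  -- `∑ i, |x i| ≤ R ∑ v, t v` converts decay in the cone coordinates into decay in `x`
  set R : ℝ := 1 + ∑ i, ∑ v : V, |toReal v.1 i| with hR
  have hR0 : 0 < R := by positivity
  refine ⟨C, δ / R, hC, by positivity, hbound.mono fun ε hε x hx => ?_⟩
  obtain ⟨t, ht0, ht⟩ := hgen x ((hmem x).2 fun i j m hm => by
    rw [pairing_sub]; exact sub_nonneg.2 (hx i j m hm))
  have h1 := hε fun v => ⟨t v, ht0 v⟩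
  have h2 : conePoint (fun v : V => v.1) (fun v => (⟨t v, ht0 v⟩ : ℝ≥0)) = x := ht.symm
  rw [h2] at h1
  refine h1.trans (mul_le_mul_of_nonneg_left (Real.exp_le_exp.2 (neg_le_neg ?_)) hC)
  have h3 : ∑ i, |x i| ≤ R * ∑ v, t v := by
    have h4 : ∀ i, |x i| ≤ ∑ v : V, |toReal v.1 i| * ∑ v, t v := by
      intro i
      have h5 : x i = ∑ v, t v * toReal v.1 i := by rw [ht]; simp
      rw [h5]
      refine (Finset.abs_sum_le_sum_abs _ _).trans (Finset.sum_le_sum fun v _ => ?_)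
      rw [abs_mul, abs_of_nonneg (ht0 v), mul_comm]
      exact mul_le_mul_of_nonneg_left (Finset.single_le_sum (f := t) (fun v _ => ht0 v)
        (Finset.mem_univ v)) (abs_nonneg _)
    refine (Finset.sum_le_sum fun i _ => h4 i).trans ?_
    simp only [← Finset.sum_mul]
    have : 0 ≤ ∑ v, t v := Finset.sum_nonneg fun v _ => ht0 v
    gcongr
    rw [hR]
    linarith
  change δ / R * ∑ i, |x i| ≤ δ * ∑ v, t v
  rw [div_mul_eq_mul_div, div_le_iff₀ hR0, mul_assoc, mul_comm _ R]
  gcongr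

theorem integrable_exp_neg_sum_abs {δ : ℝ} (hδ : 0 < δ) :
    Integrable fun x : Fin n → ℝ => Real.exp (-(δ * ∑ i, |x i|)) := by
  have h1 := Integrable.fintype_prod (μ := fun _ : Fin n => (volume : Measure ℝ))
    (f := fun _ : Fin n => fun x : ℝ => Real.exp (-(δ * |x|)))
    fun _ => integrable_exp_neg_mul_abs hδ
  refine h1.congr (Eventually.of_forall fun x => ?_)
  simp only [Finset.mul_sum, ← Finset.sum_neg_distrib, Real.exp_sum]

/-- The combination is dominated, uniformly in small `ε`, by the sum over all choices of monomials
of the bounds on the corresponding cones. -/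
theorem locallyFinite_of_re_pos
    (hpos : ∀ ρ : Fin n → ℝ, ρ ≠ 0 → ∀ e ∈ I.exponents ρ, 0 < e.1.re) : LocallyFinite I := by
  classical
  choose C δ hC hδ hbound using fun φ => I.exists_norm_eval_le φ hpos
  set G : (Fin n → ℝ) → ℝ := fun x => ∑ φ, C φ * Real.exp (-(δ φ * ∑ i, |x i|)) with hG
  have hGint : Integrable G := integrable_finsetSum _ fun φ _ =>
    (integrable_exp_neg_sum_abs (hδ φ)).const_mul _
  have hdom : ∀ᶠ ε in 𝓝 (0 : ℂ), ∀ x, ‖I.eval (expMap x) ε‖ ≤ G x := by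
    filter_upwards [eventually_all.2 hbound] with ε hε x
    -- `x` lies in the cone of a choice of monomials that are maximal at `x`
    choose m hm hmax using fun i => fun j : Fin (I.term i).m =>
      ((I.term i).P j).exists_pairing_eq_trop x
    refine (hε (fun i j => ⟨m i j, hm i j⟩) x fun i j m' hm' => ?_).trans ?_
    · rw [hmax]
      exact ((I.term i).P j).pairing_le_trop x hm'
    · exact Finset.single_le_sum (f := fun φ => C φ * Real.exp (-(δ φ * ∑ i, |x i|)))
        (fun φ _ => mul_nonneg (hC φ) (Real.exp_pos _).le) (Finset.mem_univ _)
  obtain ⟨r, hr, hball⟩ := Metric.eventually_nhds_iff_ball.1 hdom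
  have hdiff : ∀ x, Differentiable ℂ (fun ε => I.eval (expMap x) ε) := fun x =>
    I.eval_mem_coeffAlgebra.2 x
  have hmeas : ∀ ε, AEStronglyMeasurable (fun x => I.eval (expMap x) ε) volume := fun ε =>
    (I.continuous_eval_expMap ε).aestronglyMeasurable
  have hbd : ∀ᵐ x : Fin n → ℝ, ∀ ε ∈ Metric.ball (0 : ℂ) r, ‖I.eval (expMap x) ε‖ ≤ G x :=
    Eventually.of_forall fun x ε hε => hball ε hε x
  have hmap : ∀ g : (Fin n → ℝ) → ℂ, ∫ α, g α ∂canonicalMeasure n = ∫ x, g (expMap x) := by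
    intro g
    rw [canonicalMeasure_eq_map, measurableEmbedding_expMap.integral_map]
  have hmapi : ∀ g : (Fin n → ℝ) → ℂ, Integrable g (canonicalMeasure n) ↔
      Integrable fun x => g (expMap x) := by
    intro g
    rw [canonicalMeasure_eq_map, measurableEmbedding_expMap.integrable_map_iff]
    rfl
  have htaylor := fun k => iteratedDeriv_integral_of_dominated k hr hdiff hmeas hGint hbd
  refine ⟨?_, ?_, fun k => ?_, fun k => ?_⟩
  · filter_upwards [hdom] with ε hε
    rw [hmapi]
    exact hGint.mono' (hmeas ε) (Eventually.of_forall hε)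
  · simp only [hmap]
    refine DifferentiableOn.analyticAt (s := Metric.ball 0 r) (fun ε hε => ?_)
      (Metric.ball_mem_nhds _ hr)
    exact (hasDerivAt_integral_of_dominated_of_differentiable hdiff hmeas hGint hbd
      hε).differentiableAt.differentiableWithinAt
  · rw [hmapi]
    exact (htaylor k).1
  · simp only [hmap]
    exact (htaylor k).2

end Combination

end Euler

theorem mainTheorem1 {n : ℕ} (I : Euler.Combination n) :
    Euler.LocallyFinite I ↔
      ∀ ρ : Fin n → ℝ, ρ ≠ 0 → ∃ a : EReal, a < 0 ∧ I.TropEq ρ a := by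
  simp only [I.exists_tropEq_iff]
  exact ⟨fun h ρ hρ e he => I.re_pos_of_integrable h.integrable hρ he, I.locallyFinite_of_re_pos⟩
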